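/- We work in naive synthetic differential geometry, i.e. in the internal (intuitionistic) logic of a Grothendieck topos $\mathrm{Sh}(C,J)$ on a small site; all sets, elements and maps below are understood internally (Kripke--Joyal semantics). Let $R$ be a commutative $\mathbb{Q}$-algebra, and for $k\in\{1,2\}$ let $D_k(n)\subseteq R^n$ be the set of all $(d_1,\dots,d_n)$ for which every product of $k+1$ coordinates vanishes; put $D(n)=D_1(n)$ and $D=D(1)$. Assume the Kock--Lawvere axioms: every map $D_k(n)\to R$ ($k=1,2$) is given by a unique polynomial of total degree $\le k$. A subspace $A\subseteq X$ is *formally open* if every map $D_k(m)\to X$, $k\in\{1,2\}$, sending $0$ into $A$ factors through $A$. A *formal manifold* of dimension $n$ is a space covered by charts, i.e. by formally open subspaces, each identified with a formally open subspace of $R^n$. A *Lie group* is a formal manifold $G$ that is also a group; $e$ is its neutral element. Points $P_1,\dots,P_m$ of $G$ are *nil-square neighbours*, $\langle P_1,\dots,P_m\rangle\in G\langle m\rangle$, if they lie in a common chart and all differences $P_i-P_j$ lie in $D(n)$ there; for such points an affine combination $\sum\mu_iP_i$, $\sum\mu_i=1$, is formed in the chart (independently of the chart). Let $\mathfrak M(e)=\{P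 : \langle e,P\rangle\in G\langle 2\rangle\}$. The tangent space $T_eG=\{t\in G^D : t(0)=e\}$ is an $R$-module for the pointwise operations $(s+t)(d)=s(d)+t(d)-e$ and $(rt)(d)=(1-r)e+rt(d)$. Let $D(T_eG)$ be the set of $t\in T_eG$ with $\phi[t,t]=0$ for all $R$-bilinear $\phi:T_eG\times T_eG\to R$. The first-order logarithm $\log_e:\mathfrak M(e)\to D(T_eG)$, $\log_e(Q)(d)=e+d(Q-e)$ in a chart, is a bijection with inverse $\exp_e$. Let $\bar\lambda(P,Q,S)=\tfrac12QP^{-1}S+\tfrac12SP^{-1}Q$ for nil-square neighbours $Q,S$ of $P$, with connection symbol $\bar\Gamma_P$ in a chart: $\bar\lambda(P,Q,S)=Q+S-P+\bar\Gamma_P[Q-P,S-P]$. Points $P_1,\dots,P_m$ are in $\mathfrak M_2(e)\langle m\rangle$ if $e,P_1,\dots,P_m$ lie in a common chart and any product of three coordinates of differences of these points vanishes. For such points the second-order linear combination is $\sum\mu_iP_i=\exp_e(\sum\mu_i\log_eP_i)$, where now, in a chart and in terms of principal parts $v$ of tangent vectors $t(d)=e+dv$, $\log_e(Q)=(Q-e)-\tfrac12\bar\Gamma_e[Q-e]^2$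 and $\exp_e(v)=e+v+\tfrac12\bar\Gamma_e[v]^2$. The *Lie bracket of points* is the second-order linear combination $[P,Q]=PQ-QP$. **Theorem.** Let $G$ be a Lie group. 1. For all $P,Q\in\mathfrak M(e)$ the point $[P,Q]$ is well defined and lies in $\mathfrak M(e)$, so there is a total operation $[-,-]:\mathfrak M(e)\times\mathfrak M(e)\to\mathfrak M(e)$. 2. The first-order $\exp$-$\log$ lift $\overline{[s,t]}=\log_e[\exp_e s,\exp_e t]$, $s,t\in D(T_eG)$, takes values in $D(T_eG)$, extends to a unique $R$-bilinear map $[-,-]:T_eG\times T_eG\to T_eG$, and this map makes the $R$-module $T_eG$ a Lie algebra over $R$. 3. This bracket is the Lie bracket of left-invariant vector fields: for $t\in T_eG$ let $X^t(p,d)=p\,t(d)$; then for all $s,t\in T_eG$ the field $X^{[s,t]}$ is the Lie bracket of $X=X^s$ and $Y=X^t$, i.e. the unique vector field $Z:G\times D\to G$, $Z(p,0)=p$, with $Z_{d_1d_2}=Y_{-d_2}\circ X_{-d_1}\circ Y_{d_2}\circ X_{d_1}$ for all $d_1,d_2\in D$ (where $X_d=X(-,d)$). -/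

import Mathlib

/-!
Naive synthetic differential geometry, interpreted in the topos of sheaves of sets on a small site
`(C, J)` by Kripke-Joyal semantics: an element of a space `X` at stage `U` is a section
`x : X.obj (op U)`, universal quantifiers range over all later stages `W ⟶ U`, and existential
quantifiers are local for `J`.
-/

open CategoryTheory Opposite

universe u

namespace SDG

section Spaces

variable {C : Type u} [SmallCategory C]

/-- An internal commutative `ℚ`-algebra. -/
class InternalAlgebra (R : Cᵒᵖ ⥤ Type u) where
  commRing : ∀ U, CommRing (R.obj U)
  algebra : ∀ U, Algebra ℚ (R.obj U)
  map_one : ∀ {U W : Cᵒᵖ} (f : U ⟶ W), R.map f (1 : R.obj U) = 1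
  map_add : ∀ {U W : Cᵒᵖ} (f : U ⟶ W) (x y : R.obj U), R.map f (x + y) = R.map f x + R.map f y
  map_mul : ∀ {U W : Cᵒᵖ} (f : U ⟶ W) (x y : R.obj U), R.map f (x * y) = R.map f x * R.map f y

attribute [reducible, instance] InternalAlgebra.commRing InternalAlgebra.algebra

/-- An internal group. -/
class InternalGroup (G : Cᵒᵖ ⥤ Type u) where
  group : ∀ U, Group (G.obj U)
  map_mul : ∀ {U W : Cᵒᵖ} (f : U ⟶ W) (x y : G.obj U), G.map f (x * y) = G.map f x * G.map f y

attribute [reducible, instance] InternalGroup.group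

theorem InternalAlgebra.map_zero (R : Cᵒᵖ ⥤ Type u) [InternalAlgebra R] {U W : Cᵒᵖ} (f : U ⟶ W) :
    R.map f (0 : R.obj U) = 0 := by
  have h := InternalAlgebra.map_add f (0 : R.obj U) 0
  rw [add_zero] at h
  simpa using h

theorem InternalGroup.map_one (G : Cᵒᵖ ⥤ Type u) [InternalGroup G] {U W : Cᵒᵖ} (f : U ⟶ W) :
    G.map f (1 : G.obj U) = 1 := by
  have h := InternalGroup.map_mul f (1 : G.obj U) 1
  rw [mul_one] at h
  simpa using h

/-- The restriction map of the sheaf `R` as a ring homomorphism. -/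
def scalarRes (R : Cᵒᵖ ⥤ Type u) [InternalAlgebra R] {U W : C} (f : W ⟶ U) :
    R.obj (op U) →+* R.obj (op W) where
  toFun := fun x => R.map f.op x
  map_one' := InternalAlgebra.map_one f.op
  map_mul' := InternalAlgebra.map_mul f.op
  map_zero' := InternalAlgebra.map_zero R f.op
  map_add' := InternalAlgebra.map_add f.op

/-- `P` holds on a `J`-covering of `U`. -/
def Locally (J : GrothendieckTopology C) (U : C) (P : ∀ ⦃W : C⦄, (W ⟶ U) → Prop) : Prop :=
  ∃ S ∈ J U, ∀ ⦃W : C⦄ (f : W ⟶ U), S.arrows f → P f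

/-- An element at stage `U` of the space `Y ^ X` of maps from `X` to `Y`. -/
structure StageMap (X Y : Cᵒᵖ ⥤ Type u) (U : C) where
  app : ∀ ⦃W : C⦄, (W ⟶ U) → X.obj (op W) → Y.obj (op W)
  naturality : ∀ ⦃W W' : C⦄ (f : W ⟶ U) (g : W' ⟶ W) (x : X.obj (op W)),
    Y.map g.op (app f x) = app (g ≫ f) (X.map g.op x)

/-- Restriction of a map to a later stage. -/
def StageMap.restrict {X Y : Cᵒᵖ ⥤ Type u} {U V : C} (t : StageMap X Y U) (h : V ⟶ U) :
    StageMap X Y V where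
  app _ f x := t.app (f ≫ h) x
  naturality _ _ f g x := by rw [t.naturality, Category.assoc]

/-- The space `Rⁿ`. -/
def affineSpace (R : Cᵒᵖ ⥤ Type u) (n : ℕ) : Cᵒᵖ ⥤ Type u where
  obj U := Fin n → R.obj U
  map f := TypeCat.ofHom fun v i => R.map f (v i)

/-- The space `D_k(n)` of those `(d₁, …, dₙ)` in `Rⁿ` for which every product of `k + 1` of the
coordinates vanishes. -/
def infinitesimals (R : Cᵒᵖ ⥤ Type u) [InternalAlgebra R] (k n : ℕ) : Cᵒᵖ ⥤ Type u where
  obj U := {d : Fin n → R.obj U // ∀ a : Fin (k + 1) → Fin n, ∏ i, d (a i) = 0}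
  map {U W} f := TypeCat.ofHom fun d => ⟨fun i => R.map f (d.1 i), fun a => by
    have h := congrArg (scalarRes R f.unop) (d.2 a)
    rw [_root_.map_prod, _root_.map_zero] at h
    exact h⟩

/-- The point `0` of `D_k(n)`. -/
def infinitesimals.origin (R : Cᵒᵖ ⥤ Type u) [InternalAlgebra R] (k n : ℕ) (U : C) :
    (infinitesimals R k n).obj (op U) :=
  ⟨fun _ => 0, fun _ => Finset.prod_eq_zero (Finset.mem_univ 0) rfl⟩

/-- The space `D` of elements of `R` of square zero. -/
def disc (R : Cᵒᵖ ⥤ Type u) [InternalAlgebra R] : Cᵒᵖ ⥤ Type u where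
  obj U := {d : R.obj U // d * d = 0}
  map f := TypeCat.ofHom fun d => ⟨R.map f d.1, by
    rw [← InternalAlgebra.map_mul, d.2, InternalAlgebra.map_zero]⟩

/-- The point `0` of `D`. -/
def disc.zero (R : Cᵒᵖ ⥤ Type u) [InternalAlgebra R] (U : C) : (disc R).obj (op U) :=
  ⟨0, mul_zero 0⟩

/-- `-d` for `d` in `D`. -/
def disc.neg {R : Cᵒᵖ ⥤ Type u} [InternalAlgebra R] {U : C} (d : (disc R).obj (op U)) :
    (disc R).obj (op U) :=
  ⟨-d.1, by rw [neg_mul_neg]; exact d.2⟩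

/-- `d₁ d₂` for `d₁, d₂` in `D`. -/
def disc.mul {R : Cᵒᵖ ⥤ Type u} [InternalAlgebra R] {U : C} (d₁ d₂ : (disc R).obj (op U)) :
    (disc R).obj (op U) :=
  ⟨d₁.1 * d₂.1, by rw [mul_mul_mul_comm, d₁.2, zero_mul]⟩

/-- Kock-Lawvere axiom for `D(n)`, at all stages (the case `n = 0` holds trivially). -/
def KockLawvereI (R : Cᵒᵖ ⥤ Type u) [InternalAlgebra R] : Prop :=
  ∀ (n : ℕ) (U : C) (t : StageMap (infinitesimals R 1 n) R U),
    ∃! p : R.obj (op U) × (Fin n → R.obj (op U)),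
      ∀ ⦃W : C⦄ (f : W ⟶ U) (d : (infinitesimals R 1 n).obj (op W)),
        t.app f d = R.map f.op p.1 + ∑ j, R.map f.op (p.2 j) * d.1 j

/-- Kock-Lawvere axiom for `D₂(n)`, at all stages (the case `n = 0` holds trivially). The
coefficients `a_{jk}` are indexed by `j ≤ k`. -/
def KockLawvereII (R : Cᵒᵖ ⥤ Type u) [InternalAlgebra R] : Prop :=
  ∀ (n : ℕ) (U : C) (t : StageMap (infinitesimals R 2 n) R U),
    ∃! p : R.obj (op U) × (Fin n → R.obj (op U)) × (Fin n → Fin n → R.obj (op U)),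
      (∀ j k, k < j → p.2.2 j k = 0) ∧
      ∀ ⦃W : C⦄ (f : W ⟶ U) (d : (infinitesimals R 2 n).obj (op W)),
        t.app f d = R.map f.op p.1 + ∑ j, R.map f.op (p.2.1 j) * d.1 j
          + ∑ j, ∑ k, R.map f.op (p.2.2 j k) * d.1 j * d.1 k

/-- A part `A` of the space `X` (given at stage `U`) is formally open: every map from `D(m)` or
`D₂(m)` to `X` that sends `0` into `A` factors through `A`. -/
def FormallyOpen (R : Cᵒᵖ ⥤ Type u) [InternalAlgebra R] (X : Cᵒᵖ ⥤ Type u) {U : C}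
    (A : ∀ ⦃W : C⦄, (W ⟶ U) → Set (X.obj (op W))) : Prop :=
  ∀ (k m : ℕ), (k = 1 ∨ k = 2) → ∀ ⦃W : C⦄ (f : W ⟶ U) (t : StageMap (infinitesimals R k m) X W),
    t.app (𝟙 W) (infinitesimals.origin R k m W) ∈ A f →
      ∀ ⦃W' : C⦄ (g : W' ⟶ W) (d : (infinitesimals R k m).obj (op W')), t.app g d ∈ A (g ≫ f)

end Spaces

section Manifolds

variable {C : Type u} [SmallCategory C] (J : GrothendieckTopology C)
  (R : Cᵒᵖ ⥤ Type u) [InternalAlgebra R] (n : ℕ)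

/-- A chart of `M` at stage `U`: a formally open subspace (subsheaf) of `M` with an embedding onto
a formally open subspace of `Rⁿ`. -/
structure Chart (M : Cᵒᵖ ⥤ Type u) (U : C) where
  carrier : ∀ ⦃W : C⦄, (W ⟶ U) → Set (M.obj (op W))
  map_mem : ∀ ⦃W W' : C⦄ (f : W ⟶ U) (g : W' ⟶ W) (x : M.obj (op W)),
    x ∈ carrier f → M.map g.op x ∈ carrier (g ≫ f)
  local_mem : ∀ ⦃W : C⦄ (f : W ⟶ U) (x : M.obj (op W)),
    Locally J W (fun _ g => M.map g.op x ∈ carrier (g ≫ f)) → x ∈ carrier f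
  coord : ∀ ⦃W : C⦄ (f : W ⟶ U) (x : M.obj (op W)), x ∈ carrier f → Fin n → R.obj (op W)
  coord_map : ∀ ⦃W W' : C⦄ (f : W ⟶ U) (g : W' ⟶ W) (x : M.obj (op W)) (hx : x ∈ carrier f)
    (i : Fin n), R.map g.op (coord f x hx i) = coord (g ≫ f) (M.map g.op x) (map_mem f g x hx) i
  coord_injective : ∀ ⦃W : C⦄ (f : W ⟶ U) (x y : M.obj (op W)) (hx : x ∈ carrier f)
    (hy : y ∈ carrier f), coord f x hx = coord f y hy → x = y
  carrier_open : FormallyOpen R M carrier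
  image_open : FormallyOpen R (affineSpace R n)
    (fun _ f => {v | ∃ x, ∃ hx : x ∈ carrier f, coord f x hx = v})

/-- `M` is a formal manifold of dimension `n`: a sheaf covered by charts. -/
def IsFormalManifold (M : Cᵒᵖ ⥤ Type u) : Prop :=
  Presieve.IsSheaf J M ∧
  ∀ (U : C) (P : M.obj (op U)), Locally J U fun W f =>
    ∃ c : Chart J R n M W, M.map f.op P ∈ c.carrier (𝟙 W)

/-- The nil-square i-structure on `Aⁿ`. -/
def NilSquareTuple {A : Type u} [CommRing A] {n m : ℕ} (x : Fin m → Fin n → A) : Prop :=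
  ∀ i j a b, (x j a - x i a) * (x j b - x i b) = 0

/-- The second-order i-structure on `Aⁿ`. -/
def SecondOrderTuple {A : Type u} [CommRing A] {n m : ℕ} (x : Fin m → Fin n → A) : Prop :=
  ∀ i₁ j₁ i₂ j₂ i₃ j₃ a b c,
    (x i₁ a - x j₁ a) * (x i₂ b - x j₂ b) * (x i₃ c - x j₃ c) = 0

/-- The nil-square i-structure `M⟨m⟩` on a formal manifold: the joint image of the nil-square
i-structures of the charts. -/
def NilSquareNbrs (M : Cᵒᵖ ⥤ Type u) {U : C} {m : ℕ} (P : Fin m → M.obj (op U)) : Prop :=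
  Locally J U fun W f =>
    ∃ (c : Chart J R n M W) (hP : ∀ i, M.map f.op (P i) ∈ c.carrier (𝟙 W)),
      NilSquareTuple (fun i => c.coord (𝟙 W) _ (hP i))

/-- `Q` is the i-affine combination `∑ μᵢ Pᵢ` (with `∑ μᵢ = 1`) of the nil-square neighbours
`P₁, …, Pₘ`. -/
def IsAffineComb (M : Cᵒᵖ ⥤ Type u) {U : C} {m : ℕ} (μ : Fin m → R.obj (op U))
    (P : Fin m → M.obj (op U)) (Q : M.obj (op U)) : Prop :=
  ∑ i, μ i = 1 ∧ Locally J U fun W f =>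
    ∃ (c : Chart J R n M W) (hP : ∀ i, M.map f.op (P i) ∈ c.carrier (𝟙 W))
      (hQ : M.map f.op Q ∈ c.carrier (𝟙 W)),
      NilSquareTuple (fun i => c.coord (𝟙 W) _ (hP i)) ∧
      ∀ a, c.coord (𝟙 W) _ hQ a = ∑ i, R.map f.op (μ i) * c.coord (𝟙 W) _ (hP i) a

/-- `Q` lies in the nil-square monad `𝔐(P)`. -/
def InMonad (M : Cᵒᵖ ⥤ Type u) {U : C} (P Q : M.obj (op U)) : Prop :=
  NilSquareNbrs J R n M ![P, Q]

end Manifolds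

section LieGroups

variable {C : Type u} [SmallCategory C] (J : GrothendieckTopology C)
  (R : Cᵒᵖ ⥤ Type u) [InternalAlgebra R] (n : ℕ) (G : Cᵒᵖ ⥤ Type u) [InternalGroup G]

/-- The tangent space `T_e G`: the maps `t : D → G` with `t(0) = e`. -/
def tangentSpace : Cᵒᵖ ⥤ Type u where
  obj U := {t : StageMap (disc R) G U.unop // t.app (𝟙 U.unop) (disc.zero R U.unop) = 1}
  map {U W} f := TypeCat.ofHom fun t => ⟨t.1.restrict f.unop, by
    have h := t.1.naturality (𝟙 U.unop) f.unop (disc.zero R U.unop)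
    rw [t.2, InternalGroup.map_one] at h
    have h0 : (disc R).map f.unop.op (disc.zero R U.unop) = disc.zero R W.unop :=
      Subtype.ext (InternalAlgebra.map_zero R f)
    rw [h0] at h
    change t.1.app (𝟙 W.unop ≫ f.unop) (disc.zero R W.unop) = 1
    rw [Category.id_comp]
    rw [Category.comp_id] at h
    exact h.symm⟩
  map_id U := by
    ext t
    simp [StageMap.restrict]
  map_comp f g := by
    ext t
    simp [StageMap.restrict]

variable {R G}

/-- `t` is the first-order logarithm `log_e(Q)`, equivalently `Q = exp_e(t)`: in a chart,
`t(d) = e + d (Q - e)`. -/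
def IsLog {U : C} (Q : G.obj (op U)) (t : (tangentSpace R G).obj (op U)) : Prop :=
  Locally J U fun W h =>
    ∃ (c : Chart J R n G W) (he : (1 : G.obj (op W)) ∈ c.carrier (𝟙 W))
      (hQ : G.map h.op Q ∈ c.carrier (𝟙 W)),
      ∀ ⦃W' : C⦄ (g : W' ⟶ W) (d : (disc R).obj (op W')),
        ∃ hd : t.1.app (g ≫ h) d ∈ c.carrier g, ∀ a,
          c.coord g _ hd a = R.map g.op (c.coord (𝟙 W) _ he a)
            + d.1 * R.map g.op (c.coord (𝟙 W) _ hQ a - c.coord (𝟙 W) _ he a)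

variable (R)

/-- The canonical connection `λ_l` by left translations. -/
def leftConnection {U : C} (P Q S : G.obj (op U)) : G.obj (op U) := Q * P⁻¹ * S

/-- The canonical connection `λ_r` by right translations. -/
def rightConnection {U : C} (P Q S : G.obj (op U)) : G.obj (op U) := S * P⁻¹ * Q

/-- `L` is the value at `(P, Q, S)` of the symmetrised connection `½ λ_l + ½ λ_r` (an i-affine
combination for the nil-square i-structure). -/
def IsSymConnection {U : C} (P Q S L : G.obj (op U)) : Prop :=
  IsAffineComb J R n G ![algebraMap ℚ (R.obj (op U)) (1 / 2), algebraMap ℚ (R.obj (op U)) (1 / 2)]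
    ![leftConnection P Q S, rightConnection P Q S] L

/-- The bilinear map `Γ[v, w]` on `Aⁿ` with coefficients `Γ`. -/
def bilin {A : Type u} [CommRing A] {n : ℕ} (Γ : Fin n → Fin n → Fin n → A) (v w : Fin n → A) :
    Fin n → A :=
  fun k => ∑ i, ∑ j, Γ k i j * v i * w j

variable {R n}

/-- `Γ` is the connection symbol at `P` in the chart `c` of the symmetrised connection `λ`, i.e.
`λ(P, Q, S) = Q + S - P + Γ[Q - P, S - P]` for all `Q, S` in `𝔐(P)`. -/
def IsConnectionSymbol {W : C} (c : Chart J R n G W) (P : G.obj (op W))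
    (hP : P ∈ c.carrier (𝟙 W)) (Γ : Fin n → Fin n → Fin n → R.obj (op W)) : Prop :=
  ∀ ⦃W' : C⦄ (g : W' ⟶ W) (Q S L : G.obj (op W')),
    InMonad J R n G (G.map g.op P) Q → InMonad J R n G (G.map g.op P) S →
    IsSymConnection J R n (G.map g.op P) Q S L →
    ∀ (hQ : Q ∈ c.carrier g) (hS : S ∈ c.carrier g) (hL : L ∈ c.carrier g),
      let p : Fin n → R.obj (op W') := fun a => R.map g.op (c.coord (𝟙 W) P hP a)
      c.coord g L hL = c.coord g Q hQ + c.coord g S hS - p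
        + bilin (fun k i j => R.map g.op (Γ k i j)) (c.coord g Q hQ - p) (c.coord g S hS - p)

/-- The principal part `x - ½ Γ[x]²` of the second-order logarithm of a point with coordinates
`e + x`. -/
def logCoord {A : Type u} [CommRing A] [Algebra ℚ A] {n : ℕ} (Γ : Fin n → Fin n → Fin n → A)
    (x : Fin n → A) : Fin n → A :=
  x - algebraMap ℚ A (1 / 2) • bilin Γ x x

/-- The second-order exponential is `e + v + ½ Γ[v]²`, where `v` is the principal part. -/
def expCoord {A : Type u} [CommRing A] [Algebra ℚ A] {n : ℕ} (Γ : Fin n → Fin n → Fin n → A)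
    (v : Fin n → A) : Fin n → A :=
  v + algebraMap ℚ A (1 / 2) • bilin Γ v v

variable (R n)

/-- `S` is the second-order i-linear combination `∑ μᵢ Pᵢ = exp_e (∑ μᵢ log_e Pᵢ)` of
`⟨P₁, …, Pₘ⟩` in `𝔐₂(e)`, for the second-order exponential and logarithm of the symmetrised
connection. -/
def IsSecondOrderLinComb {U : C} {m : ℕ} (μ : Fin m → R.obj (op U)) (P : Fin m → G.obj (op U))
    (S : G.obj (op U)) : Prop :=
  Locally J U fun W h =>
    ∃ (c : Chart J R n G W) (he : (1 : G.obj (op W)) ∈ c.carrier (𝟙 W))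
      (hP : ∀ i, G.map h.op (P i) ∈ c.carrier (𝟙 W)) (hS : G.map h.op S ∈ c.carrier (𝟙 W))
      (Γ : Fin n → Fin n → Fin n → R.obj (op W)),
      IsConnectionSymbol J c 1 he Γ ∧
      SecondOrderTuple (Fin.cons (c.coord (𝟙 W) 1 he) (fun i => c.coord (𝟙 W) _ (hP i)) :
        Fin (m + 1) → Fin n → R.obj (op W)) ∧
      c.coord (𝟙 W) _ hS = c.coord (𝟙 W) 1 he + expCoord Γ
        (∑ i, R.map h.op (μ i) • logCoord Γ (c.coord (𝟙 W) _ (hP i) - c.coord (𝟙 W) 1 he))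

/-- `S` is the Lie bracket of points `[P, Q] = PQ - QP`, a second-order i-linear combination. -/
def IsPointBracket {U : C} (P Q S : G.obj (op U)) : Prop :=
  IsSecondOrderLinComb J R n ![1, -1] ![P * Q, Q * P] S

end LieGroups

section VectorFields

variable {C : Type u} [SmallCategory C] (R : Cᵒᵖ ⥤ Type u) [InternalAlgebra R]
  (G : Cᵒᵖ ⥤ Type u) [InternalGroup G]

/-- A vector field on `G` at stage `U`: a map `X : G × D → G` with `X(p, 0) = p`. -/
@[ext]
structure VectorField (U : C) where
  app : ∀ ⦃W : C⦄, (W ⟶ U) → G.obj (op W) → (disc R).obj (op W) → G.obj (op W)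
  naturality : ∀ ⦃W W' : C⦄ (f : W ⟶ U) (g : W' ⟶ W) (p : G.obj (op W)) (d : (disc R).obj (op W)),
    G.map g.op (app f p d) = app (g ≫ f) (G.map g.op p) ((disc R).map g.op d)
  app_zero : ∀ ⦃W : C⦄ (f : W ⟶ U) (p : G.obj (op W)), app f p (disc.zero R W) = p

variable {R G}

/-- The left-invariant vector field `(p, d) ↦ p · t(d)` of a tangent vector `t` at `e`. -/
def leftInvariant {U : C} (t : (tangentSpace R G).obj (op U)) : VectorField R G U where
  app _ f p d := p * t.1.app f d
  naturality _ _ f g p d := by rw [InternalGroup.map_mul, t.1.naturality]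
  app_zero W f p := by
    have h := ((tangentSpace R G).map f.op t).2
    have h' : t.1.app (𝟙 W ≫ f) (disc.zero R W) = 1 := h
    rw [Category.id_comp] at h'
    rw [h', mul_one]

/-- `Z` is the Lie bracket `[X, Y]` of vector fields: writing `X_d = X(-, d)`,
`Z_{d₁ d₂} = Y_{-d₂} ∘ X_{-d₁} ∘ Y_{d₂} ∘ X_{d₁}` for all `d₁, d₂` in `D`. -/
def IsLieBracket {U : C} (X Y Z : VectorField R G U) : Prop :=
  ∀ ⦃W : C⦄ (f : W ⟶ U) (p : G.obj (op W)) (d₁ d₂ : (disc R).obj (op W)),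
    Z.app f p (disc.mul d₁ d₂) =
      Y.app f (X.app f (Y.app f (X.app f p d₁) d₂) (disc.neg d₁)) (disc.neg d₂)

end VectorFields

section LieAlgebras

variable {C : Type u} [SmallCategory C]

/-- An internal Lie ring. -/
class InternalLieRing (T : Cᵒᵖ ⥤ Type u) where
  lieRing : ∀ U, LieRing (T.obj U)
  map_add : ∀ {U W : Cᵒᵖ} (f : U ⟶ W) (x y : T.obj U), T.map f (x + y) = T.map f x + T.map f y
  map_lie : ∀ {U W : Cᵒᵖ} (f : U ⟶ W) (x y : T.obj U), T.map f ⁅x, y⁆ = ⁅T.map f x, T.map f y⁆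

attribute [reducible, instance] InternalLieRing.lieRing

/-- An internal Lie algebra over `R`. -/
class InternalLieAlgebra (R : Cᵒᵖ ⥤ Type u) [InternalAlgebra R] (T : Cᵒᵖ ⥤ Type u)
    [InternalLieRing T] where
  lieAlgebra : ∀ U, LieAlgebra (R.obj U) (T.obj U)
  map_smul : ∀ {U W : Cᵒᵖ} (f : U ⟶ W) (r : R.obj U) (x : T.obj U),
    T.map f (r • x) = R.map f r • T.map f x

attribute [reducible, instance] InternalLieAlgebra.lieAlgebra

variable (R : Cᵒᵖ ⥤ Type u) [InternalAlgebra R]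

/-- An `R`-bilinear map `T × T → Y` at stage `U`. -/
structure StageBilin (T Y : Cᵒᵖ ⥤ Type u) [∀ U, AddCommGroup (T.obj U)]
    [∀ U, Module (R.obj U) (T.obj U)] [∀ U, AddCommGroup (Y.obj U)]
    [∀ U, Module (R.obj U) (Y.obj U)] (U : C) where
  app : ∀ ⦃W : C⦄, (W ⟶ U) →
    (T.obj (op W) →ₗ[R.obj (op W)] T.obj (op W) →ₗ[R.obj (op W)] Y.obj (op W))
  naturality : ∀ ⦃W W' : C⦄ (f : W ⟶ U) (g : W' ⟶ W) (x y : T.obj (op W)),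
    Y.map g.op (app f x y) = app (g ≫ f) (T.map g.op x) (T.map g.op y)

variable {R}

/-- `t` lies in `D(T)`: `φ[t, t] = 0` for all bilinear maps `φ : T × T → R`. -/
def InD {T : Cᵒᵖ ⥤ Type u} [InternalLieRing T] [InternalLieAlgebra R T] {U : C}
    (t : T.obj (op U)) : Prop :=
  ∀ ⦃W : C⦄ (h : W ⟶ U) (φ : StageBilin R T R W),
    φ.app (𝟙 W) (T.map h.op t) (T.map h.op t) = 0

variable (J : GrothendieckTopology C) (n : ℕ) (R) (G : Cᵒᵖ ⥤ Type u) [InternalGroup G]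
  [InternalLieRing (tangentSpace R G)] [InternalLieAlgebra R (tangentSpace R G)]

/-- The `R`-module structure of `T_e G` is the pointwise i-linear structure of `𝔐(e)`:
`(s + t)(d) = s(d) + t(d) - e` and `(r t)(d) = (1 - r) e + r t(d)`. -/
def PointwiseLinear : Prop :=
  (∀ ⦃U : C⦄ (s t : (tangentSpace R G).obj (op U)) ⦃W : C⦄ (f : W ⟶ U) (d : (disc R).obj (op W)),
    IsAffineComb J R n G ![-1, 1, 1] ![1, s.1.app f d, t.1.app f d] ((s + t).1.app f d)) ∧
  (∀ ⦃U : C⦄ (r : R.obj (op U)) (t : (tangentSpace R G).obj (op U)) ⦃W : C⦄ (f : W ⟶ U)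
    (d : (disc R).obj (op W)),
    IsAffineComb J R n G ![1 - R.map f.op r, R.map f.op r] ![1, t.1.app f d] ((r • t).1.app f d))

/-- The first-order logarithm and exponential are mutually inverse bijections between `𝔐(e)` and
`D(T_e G)`. -/
def LogBijective : Prop :=
  ∀ U : C,
    (∀ Q : G.obj (op U), InMonad J R n G 1 Q →
      ∃! t : (tangentSpace R G).obj (op U), InD (R := R) t ∧ IsLog J n Q t) ∧
    (∀ t : (tangentSpace R G).obj (op U), InD (R := R) t →
      ∃! Q : G.obj (op U), InMonad J R n G 1 Q ∧ IsLog J n Q t)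

variable {G}

/-- On `D(T_e G)` the operation `b` (at stage `U`) is the exp-log lift of the Lie bracket of points,
`b(s, t) = log_e [exp_e s, exp_e t]`. -/
def LiftsPointBracket {U : C}
    (b : ∀ ⦃W : C⦄, (W ⟶ U) → (tangentSpace R G).obj (op W) → (tangentSpace R G).obj (op W) →
      (tangentSpace R G).obj (op W)) : Prop :=
  ∀ ⦃W : C⦄ (f : W ⟶ U) (s t : (tangentSpace R G).obj (op W)),
    InD (R := R) s → InD (R := R) t →
    InD (R := R) (b f s t) ∧
    ∃ P Q S : G.obj (op W), InMonad J R n G 1 P ∧ InMonad J R n G 1 Q ∧ InMonad J R n G 1 S ∧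
      IsLog J n P s ∧ IsLog J n Q t ∧ IsPointBracket J R n P Q S ∧ IsLog J n S (b f s t)

end LieAlgebras

end SDG

/-! Everything reduces to the group commutator PQP⁻¹Q⁻¹. In a chart around the neutral element, the
Kock-Lawvere axiom for D₂(2n) makes the product of second-order points a quadratic polynomial, and
the unit laws leave only (e + x)(e + y) = e + x + y + γ(x, y) with γ bilinear
(`exists_isProductSymbol`). If x and y are nil-square, their coordinates generate an ideal in which
all triple products vanish. Comparing K(QP) with PQ then shows that the commutator has coordinates e
+ γ(x, y) - γ(y, x) (`IsProductSymbol.commutator_at`).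

The second-order combination PQ - QP has the same coordinates. The connection corrections in the
logarithms of PQ and QP depend only on x + y and cancel, and the correction in the exponential is of
degree four (`CubeZero.expCoord_sub`). Hence the bracket of points is the group commutator
(`IsLieGroup.isPointBracket_iff`), which is everywhere defined and stays in 𝔐(e).

On tangent vectors, [s, t] is characterised by [s, t](d₁d₂) = s(d₁)t(d₂)s(d₁)⁻¹t(d₂)⁻¹. Such a
vector is unique because d₁d₂ can be cancelled (`IsLieGroup.tangent_ext_mul`). Locally it exists
with principal part γ(a, b) - γ(b, a), and the local solutions glue
(`IsLieGroup.existsUnique_isTangentBracket`). The Lie algebra laws become commutator identities in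
G, the Jacobi identity being that of Hall and Witt (`IsLieGroup.jacobi`).

The comparison with the exp-log lift is a computation with principal parts
(`IsLieGroup.isLog_commutator`). The bilinear extension is unique since d₁s and d₂t always lie in
D(T_eG). For left-invariant fields, the composite of the four flows is right multiplication by the
commutator (`IsLieGroup.isLieBracket_iff`). -/

namespace SDG

/-! ### Local truth and gluing in a sheaf -/

section Stages

variable {C : Type u} [SmallCategory C] {J : GrothendieckTopology C}

theorem map_map_op (X : Cᵒᵖ ⥤ Type u) {U V W : C} (f : V ⟶ U) (g : W ⟶ V) (x : X.obj (op U)) :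
    X.map g.op (X.map f.op x) = X.map (g ≫ f).op x := by
  rw [op_comp, Functor.map_comp_apply]

theorem map_id_op (X : Cᵒᵖ ⥤ Type u) {U : C} (x : X.obj (op U)) : X.map (𝟙 U).op x = x :=
  Functor.map_id_apply X _ x

namespace Locally

variable {U : C} {P Q : ∀ ⦃W : C⦄, (W ⟶ U) → Prop}

theorem of_forall (h : ∀ ⦃W : C⦄ (f : W ⟶ U), P f) : Locally J U P :=
  ⟨⊤, J.top_mem U, fun _ f _ => h f⟩

theorem pullback (h : Locally J U P) {V : C} (f : V ⟶ U) :
    Locally J V (fun _ g => P (g ≫ f)) := by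
  obtain ⟨S, hS, hP⟩ := h
  exact ⟨S.pullback f, J.pullback_stable f hS, fun _ g hg => hP _ hg⟩

theorem bind (h : Locally J U P)
    (hPQ : ∀ ⦃W : C⦄ (f : W ⟶ U), P f → Locally J W (fun _ g => Q (g ≫ f))) :
    Locally J U Q := by
  obtain ⟨S, hS, hP⟩ := h
  choose T hT hQ using fun (W : C) (f : W ⟶ U) (hf : S.arrows f) => hPQ f (hP f hf)
  refine ⟨Sieve.bind S.arrows fun W f hf => T W f hf, J.bind_covering hS fun W f hf => hT W f hf,
    ?_⟩
  rintro W f ⟨V, g, k, hk, hg, rfl⟩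
  exact hQ V k hk g hg

theorem mono (h : Locally J U P) (hPQ : ∀ ⦃W : C⦄ (f : W ⟶ U), P f → Q f) : Locally J U Q := by
  obtain ⟨S, hS, hP⟩ := h
  exact ⟨S, hS, fun _ f hf => hPQ f (hP f hf)⟩

end Locally

theorem eq_of_locally {X : Cᵒᵖ ⥤ Type u} (hX : Presieve.IsSheaf J X) {U : C} {x y : X.obj (op U)}
    (h : Locally J U (fun _ f => X.map f.op x = X.map f.op y)) : x = y := by
  obtain ⟨S, hS, hxy⟩ := h
  exact (hX S hS).isSeparatedFor.ext fun W f hf => hxy f hf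

/-- A locally satisfiable condition with at most one solution has a global solution. -/
theorem exists_of_locally_existsUnique {X : Cᵒᵖ ⥤ Type u} (hX : Presieve.IsSheaf J X) {U : C}
    (Φ : ∀ ⦃W : C⦄, (W ⟶ U) → X.obj (op W) → Prop)
    (hmap : ∀ ⦃W V : C⦄ (f : W ⟶ U) (g : V ⟶ W) (x : X.obj (op W)), Φ f x →
      Φ (g ≫ f) (X.map g.op x))
    (huniq : ∀ ⦃W : C⦄ (f : W ⟶ U) (x y : X.obj (op W)), Φ f x → Φ f y → x = y)
    (hex : Locally J U (fun _ f => ∃ x, Φ f x)) :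
    ∃ x : X.obj (op U), Locally J U (fun _ f => Φ f (X.map f.op x)) := by
  obtain ⟨S, hS, hx⟩ := hex
  choose x hx using hx
  let y : Presieve.FamilyOfElements X S.arrows := fun _ f hf => x f hf
  have hcomp : y.Compatible := by
    rw [Presieve.compatible_iff_sieveCompatible]
    intro Y Z f g hf
    exact huniq _ _ _ (hx _ _) (hmap f g _ (hx f hf))
  obtain ⟨z, hz, -⟩ := hX S hS _ hcomp
  refine ⟨z, S, hS, fun W f hf => ?_⟩
  change Φ f (X.map f.op z)
  rw [hz f hf]
  exact hx f hf

end Stages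

/-! ### Vectors at varying stages -/

section Vectors

variable {C : Type u} [SmallCategory C] {R : Cᵒᵖ ⥤ Type u} {U W : C} (f : W ⟶ U)

/-- Restriction of a vector to a later stage. -/
def vecRes {n : ℕ} (f : W ⟶ U) (v : Fin n → R.obj (op U)) : Fin n → R.obj (op W) :=
  fun i => R.map f.op (v i)

variable {n : ℕ}

@[simp]
theorem vecRes_apply (v : Fin n → R.obj (op U)) (i : Fin n) :
    vecRes f v i = R.map f.op (v i) := rfl

theorem vecRes_id (v : Fin n → R.obj (op U)) : vecRes (𝟙 U) v = v :=
  funext fun _ => map_id_op R _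

theorem vecRes_vecRes {V : C} (g : V ⟶ W) (v : Fin n → R.obj (op U)) :
    vecRes g (vecRes f v) = vecRes (g ≫ f) v :=
  funext fun _ => map_map_op R f g _

theorem eq_of_locally_vecRes {J : GrothendieckTopology C} (hR : Presieve.IsSheaf J R)
    {v w : Fin n → R.obj (op U)} (h : Locally J U (fun _ g => vecRes g v = vecRes g w)) :
    v = w :=
  funext fun i => eq_of_locally hR (h.mono fun _ _ hg => congrFun hg i)

end Vectors

/-! ### Restriction of scalars -/

section Scalars

variable {C : Type u} [SmallCategory C] {R : Cᵒᵖ ⥤ Type u} [InternalAlgebra R] {U W : C}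
  (f : W ⟶ U)

theorem scalar_map_one : R.map f.op (1 : R.obj (op U)) = 1 := _root_.map_one (scalarRes R f)

theorem scalar_map_zero : R.map f.op (0 : R.obj (op U)) = 0 := _root_.map_zero (scalarRes R f)

theorem scalar_map_add (x y : R.obj (op U)) : R.map f.op (x + y) = R.map f.op x + R.map f.op y :=
  _root_.map_add (scalarRes R f) x y

theorem scalar_map_mul (x y : R.obj (op U)) : R.map f.op (x * y) = R.map f.op x * R.map f.op y :=
  _root_.map_mul (scalarRes R f) x y

theorem scalar_map_neg (x : R.obj (op U)) : R.map f.op (-x) = -R.map f.op x :=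
  _root_.map_neg (scalarRes R f) x

theorem scalar_map_sub (x y : R.obj (op U)) : R.map f.op (x - y) = R.map f.op x - R.map f.op y :=
  _root_.map_sub (scalarRes R f) x y

theorem scalar_map_sum {ι : Type*} (s : Finset ι) (x : ι → R.obj (op U)) :
    R.map f.op (∑ i ∈ s, x i) = ∑ i ∈ s, R.map f.op (x i) :=
  _root_.map_sum (scalarRes R f) x s

/-- A ring homomorphism out of ℚ is unique, so compatibility of the ℚ-algebra structures with
restriction comes for free. -/
theorem scalar_map_algebraMap (q : ℚ) :
    R.map f.op (algebraMap ℚ (R.obj (op U)) q) = algebraMap ℚ (R.obj (op W)) q :=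
  RingHom.congr_fun (Subsingleton.elim ((scalarRes R f).comp (algebraMap ℚ (R.obj (op U))))
    (algebraMap ℚ (R.obj (op W)))) q

variable {n : ℕ}

theorem vecRes_add (v w : Fin n → R.obj (op U)) : vecRes f (v + w) = vecRes f v + vecRes f w :=
  funext fun _ => scalar_map_add f _ _

theorem vecRes_sub (v w : Fin n → R.obj (op U)) : vecRes f (v - w) = vecRes f v - vecRes f w :=
  funext fun _ => scalar_map_sub f _ _

theorem vecRes_smul (r : R.obj (op U)) (v : Fin n → R.obj (op U)) :
    vecRes f (r • v) = R.map f.op r • vecRes f v :=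
  funext fun _ => scalar_map_mul f _ _

end Scalars

/-! ### The sheaf of tangent vectors at the neutral element -/

section Tangents

variable {C : Type u} [SmallCategory C] {J : GrothendieckTopology C} {R : Cᵒᵖ ⥤ Type u}
  [InternalAlgebra R]

@[ext]
theorem StageMap.ext {X Y : Cᵒᵖ ⥤ Type u} {U : C} {s t : StageMap X Y U}
    (h : ∀ ⦃W : C⦄ (f : W ⟶ U) (x : X.obj (op W)), s.app f x = t.app f x) : s = t := by
  cases s; cases t
  congr
  funext W f x
  exact h f x

theorem disc.map_zero {U W : C} (f : W ⟶ U) :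
    (disc R).map f.op (disc.zero R U) = disc.zero R W :=
  Subtype.ext (scalar_map_zero f)

theorem disc.map_val {U W : C} (f : W ⟶ U) (d : (disc R).obj (op U)) :
    ((disc R).map f.op d).1 = R.map f.op d.1 := rfl

variable {G : Cᵒᵖ ⥤ Type u} [InternalGroup G]

theorem group_map_mul {U W : C} (f : W ⟶ U) (x y : G.obj (op U)) :
    G.map f.op (x * y) = G.map f.op x * G.map f.op y := InternalGroup.map_mul f.op x y

theorem group_map_one {U W : C} (f : W ⟶ U) : G.map f.op (1 : G.obj (op U)) = 1 :=
  InternalGroup.map_one G f.op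

theorem group_map_inv {U W : C} (f : W ⟶ U) (x : G.obj (op U)) :
    G.map f.op x⁻¹ = (G.map f.op x)⁻¹ := by
  rw [eq_inv_iff_mul_eq_one, ← group_map_mul, inv_mul_cancel, group_map_one]

namespace tangentSpace

variable {U : C}

@[ext]
theorem ext {s t : (tangentSpace R G).obj (op U)}
    (h : ∀ ⦃W : C⦄ (f : W ⟶ U) (d : (disc R).obj (op W)), s.1.app f d = t.1.app f d) : s = t :=
  Subtype.ext (StageMap.ext h)

theorem map_app {W V : C} (t : (tangentSpace R G).obj (op U)) (f : W ⟶ U) (g : V ⟶ W)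
    (d : (disc R).obj (op V)) :
    ((tangentSpace R G).map f.op t).1.app g d = t.1.app (g ≫ f) d := rfl

theorem app_zero {W : C} (t : (tangentSpace R G).obj (op U)) (f : W ⟶ U) :
    t.1.app f (disc.zero R W) = 1 := by
  have h := t.1.naturality (𝟙 U) f (disc.zero R U)
  rwa [show t.1.app (𝟙 U) (disc.zero R U) = 1 from t.2, group_map_one, disc.map_zero,
    Category.comp_id, eq_comm] at h

/-- A tangent vector at the neutral element from its values. -/
def mk (app : ∀ ⦃W : C⦄, (W ⟶ U) → (disc R).obj (op W) → G.obj (op W))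
    (naturality : ∀ ⦃W W' : C⦄ (f : W ⟶ U) (g : W' ⟶ W) (d : (disc R).obj (op W)),
      G.map g.op (app f d) = app (g ≫ f) ((disc R).map g.op d))
    (app_zero : ∀ ⦃W : C⦄ (f : W ⟶ U), app f (disc.zero R W) = 1) :
    (tangentSpace R G).obj (op U) :=
  ⟨⟨app, naturality⟩, app_zero (𝟙 U)⟩

/-- Maps into a sheaf form a sheaf: each value at a point d is glued inside G, and uniqueness of the
glued values yields naturality and the normalisation at 0. Only the codomain has to be a sheaf. -/
theorem isSheaf (hG : Presieve.IsSheaf J G) : Presieve.IsSheaf J (tangentSpace R G) := by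
  intro U S hS x hx
  rw [Presieve.compatible_iff_sieveCompatible] at hx
  have happ : ∀ ⦃W V : C⦄ (a : W ⟶ U) (ha : S.arrows a) (g : V ⟶ W) (b : V ⟶ U)
      (hb : S.arrows b) (d : (disc R).obj (op V)), b = g ≫ a →
      (x b hb).1.app (𝟙 V) d = (x a ha).1.app g d := by
    rintro W V a ha g b hb d rfl
    rw [hx a g ha, map_app, Category.id_comp]
  -- The relation says that q agrees with the given family wherever the stage has been refined into
  -- the sieve; it has at most one solution q.
  let Φ : ∀ ⦃W : C⦄, (W ⟶ U) → (disc R).obj (op W) → G.obj (op W) → Prop :=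
    fun W f d q => ∀ ⦃V : C⦄ (k : V ⟶ W) (a : V ⟶ U) (ha : S.arrows a), a = k ≫ f →
      (x a ha).1.app (𝟙 V) ((disc R).map k.op d) = G.map k.op q
  have hloc : ∀ ⦃W : C⦄ (f : W ⟶ U), Locally J W (fun _ k => S.arrows (k ≫ f)) :=
    fun W f => ⟨S.pullback f, J.pullback_stable f hS, fun _ _ hk => hk⟩
  have huniq : ∀ ⦃W : C⦄ (f : W ⟶ U) (d : (disc R).obj (op W)) (p q : G.obj (op W)),
      Φ f d p → Φ f d q → p = q := by
    intro W f d p q hp hq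
    refine eq_of_locally hG ((hloc f).mono fun V k hk => ?_)
    rw [← hp k _ hk rfl, ← hq k _ hk rfl]
  have hmap : ∀ ⦃W V : C⦄ (f : W ⟶ U) (g : V ⟶ W) (d : (disc R).obj (op W)) (q : G.obj (op W)),
      Φ f d q → Φ (g ≫ f) ((disc R).map g.op d) (G.map g.op q) := by
    rintro W V f g d q hq V' k a ha rfl
    rw [map_map_op, map_map_op]
    exact hq (k ≫ g) _ ha (Category.assoc _ _ _).symm
  have hex : ∀ ⦃W : C⦄ (f : W ⟶ U) (d : (disc R).obj (op W)), ∃ q : G.obj (op W), Φ f d q := by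
    intro W f d
    obtain ⟨q, hq⟩ := exists_of_locally_existsUnique (J := J) hG
      (fun V g q => Φ (g ≫ f) ((disc R).map g.op d) q)
      (fun V V' g h q hq => by
        have := hmap (g ≫ f) h _ q hq
        rwa [map_map_op, ← Category.assoc] at this)
      (fun V g p q => huniq _ _ p q)
      ((hloc f).mono fun V g hg => ⟨(x (g ≫ f) hg).1.app (𝟙 V) ((disc R).map g.op d), by
        rintro V' k a ha rfl
        rw [(x (g ≫ f) hg).1.naturality, happ (g ≫ f) hg k _ ha _ rfl, Category.comp_id]⟩)
    refine ⟨q, ?_⟩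
    rintro V k a ha rfl
    refine eq_of_locally hG (hq.pullback k |>.mono fun V' g hg => ?_)
    have h1 := hg (𝟙 V') (g ≫ k ≫ f) (S.downward_closed ha g) (by simp)
    rw [map_id_op, map_id_op] at h1
    rw [map_map_op, ← h1, (x _ ha).1.naturality, happ _ ha g _ _ _ rfl, Category.comp_id,
      map_map_op]
  choose app hval using hex
  have hnat : ∀ ⦃W W' : C⦄ (f : W ⟶ U) (g : W' ⟶ W) (d : (disc R).obj (op W)),
      G.map g.op (app f d) = app (g ≫ f) ((disc R).map g.op d) := fun W W' f g d =>
    huniq _ _ _ _ (hmap f g d _ (hval f d)) (hval (g ≫ f) _)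
  have hzero : ∀ ⦃W : C⦄ (f : W ⟶ U), app f (disc.zero R W) = 1 := by
    refine fun W f => huniq f (disc.zero R W) _ _ (hval f _) ?_
    rintro V k a ha rfl
    rw [disc.map_zero, app_zero, group_map_one]
  refine ⟨mk app hnat hzero, ?_, ?_⟩
  · intro W f hf
    ext V g d
    have := hval (g ≫ f) d (𝟙 V) _ (S.downward_closed hf g) (Category.id_comp _).symm
    rw [map_id_op, map_id_op, happ f hf g _ _ _ rfl] at this
    rw [map_app, this]
    rfl
  · intro t ht
    ext W f d
    refine huniq f d _ _ ?_ (hval f d)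
    rintro V k a ha rfl
    rw [← ht _ ha, map_app, t.1.naturality, Category.id_comp]

end tangentSpace

end Tangents

/-! ### Nil-square vectors and ideals with vanishing triple products -/

section NilSquare

variable {A : Type u} [CommRing A] {n : ℕ}

/-- All products of two coordinates vanish. -/
def NilSq (x : Fin n → A) : Prop := ∀ i j, x i * x j = 0

theorem NilSq.smul {x : Fin n → A} (hx : NilSq x) (r : A) : NilSq (r • x) := fun i j => by
  simp only [Pi.smul_apply, smul_eq_mul]
  rw [mul_mul_mul_comm, hx, mul_zero]

theorem NilSq.smul_of_mul_self {d : A} (hd : d * d = 0) (x : Fin n → A) : NilSq (d • x) :=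
  fun i j => by
    simp only [Pi.smul_apply, smul_eq_mul]
    rw [mul_mul_mul_comm, hd, zero_mul]

theorem NilSq.mulVec {x : Fin n → A} (hx : NilSq x) (M : Matrix (Fin n) (Fin n) A) :
    NilSq (M.mulVec x) := fun i j => by
  simp only [Matrix.mulVec, dotProduct]
  rw [Finset.sum_mul_sum]
  refine Finset.sum_eq_zero fun k _ => Finset.sum_eq_zero fun l _ => ?_
  rw [mul_mul_mul_comm, hx, mul_zero]

/-- Any product of three elements of the ideal vanishes. -/
def CubeZero (I : Ideal A) : Prop := ∀ a ∈ I, ∀ b ∈ I, ∀ c ∈ I, a * b * c = 0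

theorem cubeZero_span {S : Set A} (hS : ∀ a ∈ S, ∀ b ∈ S, ∀ c ∈ S, a * b * c = 0) :
    CubeZero (Ideal.span S) := by
  intro a ha b hb c hc
  have h1 : ∀ a ∈ S, ∀ b ∈ S, a * b * c = 0 := by
    intro a ha b hb
    induction hc using Submodule.span_induction with
    | mem x h => exact hS a ha b hb x h
    | zero => exact mul_zero _
    | add x y _ _ hx hy => rw [mul_add, hx, hy, add_zero]
    | smul r x _ hx => rw [smul_eq_mul, mul_left_comm, hx, mul_zero]
  have h2 : ∀ a ∈ S, a * b * c = 0 := by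
    intro a ha
    induction hb using Submodule.span_induction with
    | mem x h => exact h1 a ha x h
    | zero => rw [mul_zero, zero_mul]
    | add x y _ _ hx hy => rw [mul_add, add_mul, hx, hy, add_zero]
    | smul r x _ hx => rw [smul_eq_mul, mul_left_comm, mul_assoc, hx, mul_zero]
  induction ha using Submodule.span_induction with
  | mem x h => exact h2 x h
  | zero => rw [zero_mul, zero_mul]
  | add x y _ _ hx hy => rw [add_mul, add_mul, hx, hy, add_zero]
  | smul r x _ hx => rw [smul_eq_mul, mul_assoc, mul_assoc, ← mul_assoc x, hx, mul_zero]

/-- Among three coordinates taken from two vectors, two come from the same vector, so their product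
already vanishes. -/
theorem NilSq.exists_cubeZero {x y : Fin n → A} (hx : NilSq x) (hy : NilSq y) :
    ∃ I : Ideal A, CubeZero I ∧ (∀ i, x i ∈ I) ∧ ∀ i, y i ∈ I := by
  refine ⟨Ideal.span (Set.range x ∪ Set.range y), cubeZero_span ?_,
    fun i => Ideal.subset_span (Or.inl ⟨i, rfl⟩), fun i => Ideal.subset_span (Or.inr ⟨i, rfl⟩)⟩
  rintro _ (⟨i, rfl⟩ | ⟨i, rfl⟩) _ (⟨j, rfl⟩ | ⟨j, rfl⟩) _ (⟨k, rfl⟩ | ⟨k, rfl⟩)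
  · rw [hx, zero_mul]
  · rw [hx, zero_mul]
  · rw [mul_right_comm, hx, zero_mul]
  · rw [mul_assoc, hy, mul_zero]
  · rw [mul_assoc, hx, mul_zero]
  · rw [mul_right_comm, hy, zero_mul]
  · rw [hy, zero_mul]
  · rw [hy, zero_mul]

theorem bilin_add_left (Γ : Fin n → Fin n → Fin n → A) (u v w : Fin n → A) :
    bilin Γ (u + v) w = bilin Γ u w + bilin Γ v w := by
  ext k
  simp only [bilin, Pi.add_apply, ← Finset.sum_add_distrib]
  exact Finset.sum_congr rfl fun i _ => Finset.sum_congr rfl fun j _ => by ring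

theorem bilin_add_right (Γ : Fin n → Fin n → Fin n → A) (u v w : Fin n → A) :
    bilin Γ u (v + w) = bilin Γ u v + bilin Γ u w := by
  ext k
  simp only [bilin, Pi.add_apply, ← Finset.sum_add_distrib]
  exact Finset.sum_congr rfl fun i _ => Finset.sum_congr rfl fun j _ => by ring

theorem bilin_smul_left (Γ : Fin n → Fin n → Fin n → A) (r : A) (v w : Fin n → A) :
    bilin Γ (r • v) w = r • bilin Γ v w := by
  ext k
  simp only [bilin, Pi.smul_apply, smul_eq_mul, Finset.mul_sum]
  exact Finset.sum_congr rfl fun i _ => Finset.sum_congr rfl fun j _ => by ring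

theorem bilin_smul_right (Γ : Fin n → Fin n → Fin n → A) (r : A) (v w : Fin n → A) :
    bilin Γ v (r • w) = r • bilin Γ v w := by
  ext k
  simp only [bilin, Pi.smul_apply, smul_eq_mul, Finset.mul_sum]
  exact Finset.sum_congr rfl fun i _ => Finset.sum_congr rfl fun j _ => by ring

theorem bilin_eq_zero {Γ : Fin n → Fin n → Fin n → A} {v w : Fin n → A}
    (h : ∀ i j, v i * w j = 0) : bilin Γ v w = 0 := by
  ext k
  exact Finset.sum_eq_zero fun i _ => Finset.sum_eq_zero fun j _ => by
    rw [mul_assoc, h, mul_zero]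

theorem bilin_mem {I : Ideal A} (Γ : Fin n → Fin n → Fin n → A) {v w : Fin n → A}
    (hv : ∀ i, v i ∈ I) (k : Fin n) : bilin Γ v w k ∈ I :=
  sum_mem fun i _ => sum_mem fun _ _ =>
    Ideal.mul_mem_right _ _ (Ideal.mul_mem_left _ _ (hv i))

/-- A bilinear value is of degree two in the ideal; one further factor makes a triple product. This
truncates all later computations. -/
theorem bilin_mul_eq_zero {I : Ideal A} (hI : CubeZero I) (Γ : Fin n → Fin n → Fin n → A)
    {v w : Fin n → A} (hv : ∀ i, v i ∈ I) (hw : ∀ i, w i ∈ I) {a : A} (ha : a ∈ I) (k : Fin n) :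
    bilin Γ v w k * a = 0 := by
  simp only [bilin, Finset.sum_mul]
  refine Finset.sum_eq_zero fun i _ => Finset.sum_eq_zero fun j _ => ?_
  rw [mul_assoc, mul_assoc, ← mul_assoc (v i), hI _ (hv i) _ (hw j) _ ha, mul_zero]

theorem vecRes_bilin {C : Type u} [SmallCategory C] {R : Cᵒᵖ ⥤ Type u} [InternalAlgebra R]
    {U W : C} (f : W ⟶ U) (Γ : Fin n → Fin n → Fin n → R.obj (op U)) (v w : Fin n → R.obj (op U)) :
    vecRes f (bilin Γ v w) =
      bilin (fun k i j => R.map f.op (Γ k i j)) (vecRes f v) (vecRes f w) := by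
  ext k
  simp only [bilin, vecRes_apply, scalar_map_sum, scalar_map_mul]

theorem NilSq.vecRes {C : Type u} [SmallCategory C] {R : Cᵒᵖ ⥤ Type u} [InternalAlgebra R]
    {U W : C} (f : W ⟶ U) {v : Fin n → R.obj (op U)} (hv : NilSq v) : NilSq (vecRes f v) :=
  fun i j => by rw [vecRes_apply, vecRes_apply, ← scalar_map_mul, hv, scalar_map_zero]

end NilSquare

/-! ### Maps into affine space -/

section VectorValued

variable {C : Type u} [SmallCategory C] {R : Cᵒᵖ ⥤ Type u} {U : C}

/-- A map into `Rⁿ` as a vector-valued map. -/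
def StageMap.vec {X : Cᵒᵖ ⥤ Type u} {n : ℕ} (τ : StageMap X (affineSpace R n) U) ⦃W : C⦄
    (f : W ⟶ U) (x : X.obj (op W)) : Fin n → R.obj (op W) :=
  τ.app f x

theorem StageMap.vec_naturality {X : Cᵒᵖ ⥤ Type u} {n : ℕ} (τ : StageMap X (affineSpace R n) U)
    {W W' : C} (f : W ⟶ U) (g : W' ⟶ W) (x : X.obj (op W)) :
    vecRes g (τ.vec f x) = τ.vec (g ≫ f) (X.map g.op x) :=
  τ.naturality f g x

/-- A map into `Rⁿ` from its coordinates. -/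
def StageMap.ofVec {X : Cᵒᵖ ⥤ Type u} {n : ℕ}
    (app : ∀ ⦃W : C⦄, (W ⟶ U) → X.obj (op W) → Fin n → R.obj (op W))
    (naturality : ∀ ⦃W W' : C⦄ (f : W ⟶ U) (g : W' ⟶ W) (x : X.obj (op W)),
      vecRes g (app f x) = app (g ≫ f) (X.map g.op x)) :
    StageMap X (affineSpace R n) U where
  app _ f x := app f x
  naturality _ _ f g x := naturality f g x

end VectorValued

/-! ### Consequences of the Kock-Lawvere axioms -/

section KockLawvere

variable {C : Type u} [SmallCategory C] {R : Cᵒᵖ ⥤ Type u} [InternalAlgebra R] {U : C}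

/-- The coordinates of a map into `Rⁿ`. -/
def StageMap.component {X : Cᵒᵖ ⥤ Type u} {n : ℕ} (τ : StageMap X (affineSpace R n) U)
    (i : Fin n) : StageMap X R U where
  app _ f x := τ.app f x i
  naturality _ _ f g x := congrFun (τ.naturality f g x) i

theorem KockLawvereI.exists_matrix (hI : KockLawvereI R) {m n : ℕ}
    (τ : StageMap (infinitesimals R 1 m) (affineSpace R n) U) :
    ∃ A : Matrix (Fin n) (Fin m) (R.obj (op U)), ∀ ⦃W : C⦄ (f : W ⟶ U)
      (d : (infinitesimals R 1 m).obj (op W)),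
      τ.vec f d = τ.vec f (infinitesimals.origin R 1 m W) + (A.map (scalarRes R f)).mulVec d.1 := by
  choose p hp _ using fun i => hI m U (τ.component i)
  refine ⟨fun i => (p i).2, fun W f d => ?_⟩
  ext i
  have h0 := hp i f (infinitesimals.origin R 1 m W)
  have h1 := hp i f d
  simp only [infinitesimals.origin, mul_zero, Finset.sum_const_zero, add_zero] at h0
  rw [← h0] at h1
  exact h1

theorem KockLawvereII.exists_quadratic (hII : KockLawvereII R) {m n : ℕ}
    (τ : StageMap (infinitesimals R 2 m) (affineSpace R n) U) :
    ∃ (p : Fin n → R.obj (op U)) (A : Fin n → Fin m → R.obj (op U))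
      (B : Fin n → Fin m → Fin m → R.obj (op U)), ∀ ⦃W : C⦄ (f : W ⟶ U)
      (d : (infinitesimals R 2 m).obj (op W)) (i : Fin n),
      τ.vec f d i = R.map f.op (p i) + ∑ j, R.map f.op (A i j) * d.1 j
        + ∑ j, ∑ k, R.map f.op (B i j k) * d.1 j * d.1 k := by
  choose p hp _ using fun i => hII m U (τ.component i)
  exact ⟨_, _, _, fun W f d i => (hp i).2 f d⟩

/-- A point of `D` as a point of `D(1)`. -/
def disc.toInfinitesimals {U : C} (d : (disc R).obj (op U)) :
    (infinitesimals R 1 1).obj (op U) :=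
  ⟨fun _ => d.1, fun _ => by rw [Fin.prod_univ_two]; exact d.2⟩

/-- A point of `D(1)` as a point of `D`. -/
def infinitesimals.toDisc {U : C} (d : (infinitesimals R 1 1).obj (op U)) :
    (disc R).obj (op U) :=
  ⟨d.1 0, by simpa [pow_two] using d.2 (fun _ => 0)⟩

/-- A map `D → Rⁿ` is affine. -/
theorem KockLawvereI.exists_slope (hI : KockLawvereI R) {n : ℕ}
    (τ : StageMap (disc R) (affineSpace R n) U) :
    ∃ a : Fin n → R.obj (op U), ∀ ⦃W : C⦄ (f : W ⟶ U) (d : (disc R).obj (op W)),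
      τ.vec f d = τ.vec f (disc.zero R W) + d.1 • vecRes f a := by
  obtain ⟨A, hA⟩ := hI.exists_matrix (StageMap.ofVec (X := infinitesimals R 1 1)
    (fun _ f d => τ.vec f (infinitesimals.toDisc d))
    (fun _ _ f g d => τ.vec_naturality f g (infinitesimals.toDisc d)))
  refine ⟨fun i => A i 0, fun W f d => (hA f (disc.toInfinitesimals d)).trans ?_⟩
  ext i
  change τ.vec f _ i + _ = τ.vec f _ i + _
  congr 1
  simp only [Matrix.mulVec, dotProduct, Fin.sum_univ_one, Pi.smul_apply, vecRes_apply]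
  exact mul_comm _ _

/-- Universally quantified elements of `D` may be cancelled. -/
theorem KockLawvereI.cancel_disc (hI : KockLawvereI R) {n : ℕ} {a b : Fin n → R.obj (op U)}
    (h : ∀ ⦃W : C⦄ (f : W ⟶ U) (d : (disc R).obj (op W)),
      d.1 • vecRes f a = d.1 • vecRes f b) : a = b := by
  ext i
  -- Both (0, aᵢ) and (0, bᵢ) represent the map d ↦ d aᵢ, so the uniqueness half of the axiom
  -- identifies them.
  obtain ⟨p, -, hp⟩ := hI 1 U
    ⟨fun _ f d => d.1 0 * R.map f.op (a i), fun _ _ f g d => by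
      rw [scalar_map_mul, map_map_op]; rfl⟩
  have ha := hp (0, fun _ => a i) fun W f d => by
    simp [scalar_map_zero, mul_comm]
  have hb := hp (0, fun _ => b i) fun W f d => by
    have := congrFun (h f (infinitesimals.toDisc d)) i
    simp only [Pi.smul_apply, vecRes_apply, smul_eq_mul] at this
    change d.1 0 * R.map f.op (a i) = _
    simp only [scalar_map_zero, zero_add, Fin.sum_univ_one]
    rw [mul_comm _ (d.1 0)]
    exact this
  exact congrFun (congrArg Prod.snd (ha.trans hb.symm)) 0

/-- The two factors are cancelled one after the other, the second at a later stage than the first.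
-/
theorem KockLawvereI.cancel_disc_mul (hI : KockLawvereI R) {n : ℕ} {a b : Fin n → R.obj (op U)}
    (h : ∀ ⦃W : C⦄ (f : W ⟶ U) (d₁ d₂ : (disc R).obj (op W)),
      (d₁.1 * d₂.1) • vecRes f a = (d₁.1 * d₂.1) • vecRes f b) : a = b := by
  refine hI.cancel_disc fun W f d => hI.cancel_disc fun V g d' => ?_
  have := h (g ≫ f) d' ((disc R).map g.op d)
  rw [mul_smul, mul_smul, disc.map_val] at this
  rwa [vecRes_smul, vecRes_smul, vecRes_vecRes, vecRes_vecRes]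

end KockLawvere

/-! ### Points, infinitesimal maps and transition functions in charts -/

section Charts

variable {C : Type u} [SmallCategory C] {J : GrothendieckTopology C}
  {R : Cᵒᵖ ⥤ Type u} [InternalAlgebra R] {n : ℕ} {M : Cᵒᵖ ⥤ Type u} {U : C}

namespace Chart

/-- The point `x` lies in the chart and has coordinates `v`. -/
def At (c : Chart J R n M U) {W : C} (f : W ⟶ U) (x : M.obj (op W)) (v : Fin n → R.obj (op W)) :
    Prop :=
  ∃ hx : x ∈ c.carrier f, c.coord f x hx = v

variable {c c' : Chart J R n M U} {W : C} {f : W ⟶ U}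

theorem at_coord {x : M.obj (op W)} (hx : x ∈ c.carrier f) : c.At f x (c.coord f x hx) := ⟨hx, rfl⟩

theorem At.unique {x : M.obj (op W)} {v w : Fin n → R.obj (op W)} (hv : c.At f x v)
    (hw : c.At f x w) : v = w :=
  hv.2.symm.trans hw.2

theorem At.inj {x y : M.obj (op W)} {v : Fin n → R.obj (op W)} (hx : c.At f x v)
    (hy : c.At f y v) : x = y :=
  c.coord_injective f x y hx.1 hy.1 (hx.2.trans hy.2.symm)

theorem At.map {x : M.obj (op W)} {v : Fin n → R.obj (op W)} (hx : c.At f x v) {V : C}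
    (g : V ⟶ W) : c.At (g ≫ f) (M.map g.op x) (vecRes g v) := by
  obtain ⟨hx, rfl⟩ := hx
  exact ⟨c.map_mem f g x hx, funext fun i => (c.coord_map f g x hx i).symm⟩

theorem At.map_id {x : M.obj (op U)} {v : Fin n → R.obj (op U)} (hx : c.At (𝟙 U) x v) {V : C}
    (g : V ⟶ U) : c.At g (M.map g.op x) (vecRes g v) := by
  simpa using hx.map g

theorem At.of_locally (hR : Presieve.IsSheaf J R) {x : M.obj (op W)} {v : Fin n → R.obj (op W)}
    (h : Locally J W (fun _ g => c.At (g ≫ f) (M.map g.op x) (vecRes g v))) : c.At f x v := by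
  have hx : x ∈ c.carrier f := c.local_mem f x (h.mono fun _ _ hg => hg.1)
  exact ⟨hx, eq_of_locally_vecRes hR (h.mono fun V g hg => ((at_coord hx).map g).unique hg)⟩

/-- Restriction of a chart to a later stage. -/
def restrict (c : Chart J R n M U) (f : W ⟶ U) : Chart J R n M W where
  carrier _ g := c.carrier (g ≫ f)
  map_mem _ _ g h x hx := by
    rw [Category.assoc]
    exact c.map_mem _ h x hx
  local_mem _ g x hx := by
    refine c.local_mem _ x (hx.mono fun V h hh => ?_)
    rwa [← Category.assoc]
  coord _ g x hx := c.coord (g ≫ f) x hx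
  coord_map V V' g h x hx i := by
    rw [c.coord_map]
    simp only [Category.assoc]
  coord_injective _ g x y hx hy hxy := c.coord_injective _ x y hx hy hxy
  carrier_open k m hk V g t ht V' h d := by
    have := c.carrier_open k m hk (g ≫ f) t ht h d
    change _ ∈ c.carrier _
    rwa [Category.assoc]
  image_open k m hk V g t ht V' h d := by
    have := c.image_open k m hk (g ≫ f) t ht h d
    rwa [← Category.assoc] at this

theorem restrict_at {V : C} {g : V ⟶ W} {x : M.obj (op V)} {v : Fin n → R.obj (op V)} :
    (c.restrict f).At g x v ↔ c.At (g ≫ f) x v := Iff.rfl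

theorem restrict_at_id {x : M.obj (op W)} {v : Fin n → R.obj (op W)} :
    (c.restrict f).At (𝟙 W) x v ↔ c.At f x v := by
  rw [restrict_at, Category.id_comp]

/-- Formal openness of the image of the chart: an infinitesimal map into Rⁿ starting at a point of
the chart stays in the image. Injectivity of coordinates makes the lifted values natural. -/
theorem exists_lift {k m : ℕ} (hk : k = 1 ∨ k = 2)
    (τ : StageMap (infinitesimals R k m) (affineSpace R n) U) {P : M.obj (op U)}
    (hP : c.At (𝟙 U) P (τ.vec (𝟙 U) (infinitesimals.origin R k m U))) :
    ∃ σ : StageMap (infinitesimals R k m) M U, ∀ ⦃W : C⦄ (f : W ⟶ U)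
      (d : (infinitesimals R k m).obj (op W)), c.At f (σ.app f d) (τ.vec f d) := by
  have h : ∀ ⦃W : C⦄ (f : W ⟶ U) (d : (infinitesimals R k m).obj (op W)),
      ∃ x, c.At f x (τ.vec f d) := by
    intro W f d
    obtain ⟨x, hx, hxd⟩ := c.image_open k m hk (𝟙 U) τ ⟨P, hP⟩ f d
    have : c.At (f ≫ 𝟙 U) x (τ.vec f d) := ⟨hx, hxd⟩
    rw [Category.comp_id] at this
    exact ⟨x, this⟩
  choose σ hσ using h
  refine ⟨⟨σ, fun W W' f g x => ?_⟩, hσ⟩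
  refine ((hσ f x).map g).inj ?_
  have := hσ (g ≫ f) ((infinitesimals R k m).map g.op x)
  rwa [← τ.vec_naturality] at this

/-- Formal openness of the chart in M itself, the counterpart of `exists_lift`; it turns a map into
M into polynomial coordinates. -/
theorem exists_coordMap {k m : ℕ} (hk : k = 1 ∨ k = 2) (σ : StageMap (infinitesimals R k m) M U)
    (h0 : σ.app (𝟙 U) (infinitesimals.origin R k m U) ∈ c.carrier (𝟙 U)) :
    ∃ τ : StageMap (infinitesimals R k m) (affineSpace R n) U, ∀ ⦃W : C⦄ (f : W ⟶ U)
      (d : (infinitesimals R k m).obj (op W)), c.At f (σ.app f d) (τ.vec f d) := by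
  have h : ∀ ⦃W : C⦄ (f : W ⟶ U) (d : (infinitesimals R k m).obj (op W)),
      σ.app f d ∈ c.carrier f := by
    intro W f d
    simpa only [Category.comp_id] using c.carrier_open k m hk (𝟙 U) σ h0 f d
  refine ⟨⟨fun W f d => c.coord f _ (h f d), fun W W' f g x => ?_⟩, fun W f d => at_coord _⟩
  have h1 := (at_coord (h f x)).map g
  rw [σ.naturality] at h1
  exact h1.unique (at_coord (h (g ≫ f) _))

/-- The infinitesimal neighbourhood of a point of a chart, traversed along some of the coordinates
of `D_k(m)`. -/
theorem exists_shift {k m : ℕ} (hk : k = 1 ∨ k = 2) {P : M.obj (op U)}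
    {p : Fin n → R.obj (op U)} (hP : c.At (𝟙 U) P p) (ι : Fin n → Fin m) :
    ∃ σ : StageMap (infinitesimals R k m) M U, ∀ ⦃W : C⦄ (f : W ⟶ U)
      (d : (infinitesimals R k m).obj (op W)),
      c.At f (σ.app f d) (vecRes f p + fun i => d.1 (ι i)) := by
  refine exists_lift (P := P) hk (StageMap.ofVec (fun W f d => vecRes f p + fun i => d.1 (ι i))
    fun W W' f g d => ?_) ?_
  · rw [vecRes_add, vecRes_vecRes]
    rfl
  · change c.At _ _ (vecRes (𝟙 U) p + (0 : Fin n → R.obj (op U)))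
    rwa [vecRes_id, add_zero]

/-- A nil-square vector as a point of `D(n)`. -/
def nilSqPoint {W : C} {x : Fin n → R.obj (op W)} (hx : NilSq x) :
    (infinitesimals R 1 n).obj (op W) :=
  ⟨x, fun a => by rw [Fin.prod_univ_two]; exact hx _ _⟩

theorem exists_at_add {P : M.obj (op U)} {p : Fin n → R.obj (op U)} (hP : c.At (𝟙 U) P p)
    (f : W ⟶ U) {x : Fin n → R.obj (op W)} (hx : NilSq x) : ∃ Q, c.At f Q (vecRes f p + x) := by
  obtain ⟨σ, hσ⟩ := exists_shift (Or.inl rfl) hP id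
  exact ⟨_, hσ f (nilSqPoint hx)⟩

/-- Transition functions are affine on `D(n)`. -/
theorem exists_transition (hI : KockLawvereI R) {P : M.obj (op U)} {p p' : Fin n → R.obj (op U)}
    (hP : c.At (𝟙 U) P p) (hP' : c'.At (𝟙 U) P p') :
    ∃ A : Matrix (Fin n) (Fin n) (R.obj (op U)), ∀ ⦃W : C⦄ (f : W ⟶ U) (x : Fin n → R.obj (op W))
      (Q : M.obj (op W)), NilSq x → c.At f Q (vecRes f p + x) →
        c'.At f Q (vecRes f p' + (A.map (scalarRes R f)).mulVec x) := by
  obtain ⟨σ, hσ⟩ := exists_shift (k := 1) (Or.inl rfl) hP id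
  have h0 : ∀ ⦃W : C⦄ (f : W ⟶ U),
      σ.app f (infinitesimals.origin R 1 n W) = M.map f.op P := fun W f => by
    have h := hσ f (infinitesimals.origin R 1 n W)
    rw [show (fun i => (infinitesimals.origin R 1 n W).1 (id i)) = 0 from rfl, add_zero] at h
    exact h.inj (hP.map_id f)
  have h0' : σ.app (𝟙 U) (infinitesimals.origin R 1 n U) ∈ c'.carrier (𝟙 U) := by
    rw [h0, map_id_op]
    exact hP'.1
  obtain ⟨τ, hτ⟩ := exists_coordMap (Or.inl rfl) σ h0'
  obtain ⟨A, hA⟩ := hI.exists_matrix τ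
  refine ⟨A, fun W f x Q hx hQ => ?_⟩
  have h1 := hτ f (nilSqPoint hx)
  have h2 := hτ f (infinitesimals.origin R 1 n W)
  rw [h0] at h2
  rw [hA, h2.unique (hP'.map_id f)] at h1
  rwa [(hσ f (nilSqPoint hx)).inj hQ] at h1

end Chart

end Charts

/-! ### Nil-square neighbours and affine combinations, independently of the chart -/

section Neighbours

variable {C : Type u} [SmallCategory C] {J : GrothendieckTopology C}
  {R : Cᵒᵖ ⥤ Type u} [InternalAlgebra R] {n : ℕ} {M : Cᵒᵖ ⥤ Type u} {U : C}
  {c : Chart J R n M U}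

theorem NilSquareTuple.vecRes {m : ℕ} {x : Fin m → Fin n → R.obj (op U)} (hx : NilSquareTuple x)
    {W : C} (f : W ⟶ U) : NilSquareTuple (fun i => vecRes f (x i)) := fun i j a b => by
  simp only [vecRes_apply, ← scalar_map_sub, ← scalar_map_mul]
  rw [hx, scalar_map_zero]

theorem NilSquareNbrs.of_at {m : ℕ} {P : Fin m → M.obj (op U)} {x : Fin m → Fin n → R.obj (op U)}
    (hP : ∀ i, c.At (𝟙 U) (P i) (x i)) (hx : NilSquareTuple x) : NilSquareNbrs J R n M P := by
  refine Locally.of_forall fun W f => ?_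
  have h : ∀ i, (c.restrict f).At (𝟙 W) (M.map f.op (P i)) (vecRes f (x i)) := fun i =>
    Chart.restrict_at_id.2 ((hP i).map_id f)
  refine ⟨c.restrict f, fun i => (h i).1, ?_⟩
  rw [funext fun i => (h i).2]
  exact hx.vecRes f

theorem IsAffineComb.of_locally_at {m : ℕ} {P : Fin m → M.obj (op U)} {Q : M.obj (op U)}
    {μ : Fin m → R.obj (op U)} (hμ : ∑ i, μ i = 1)
    (h : Locally J U fun W f => ∃ (c : Chart J R n M W) (x : Fin m → Fin n → R.obj (op W)),
      (∀ i, c.At (𝟙 W) (M.map f.op (P i)) (x i)) ∧ NilSquareTuple x ∧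
        c.At (𝟙 W) (M.map f.op Q) (∑ i, R.map f.op (μ i) • x i)) :
    IsAffineComb J R n M μ P Q := by
  refine ⟨hμ, h.mono fun W f ⟨c, x, hP, hx, hQ⟩ => ⟨c, fun i => (hP i).1, hQ.1, ?_, fun a => ?_⟩⟩
  · rwa [funext fun i => (hP i).2]
  · rw [hQ.2]
    simp only [(hP _).2, Finset.sum_apply, Pi.smul_apply, smul_eq_mul]

theorem nilSquareTuple_add_smul {A : Type u} [CommRing A] {m : ℕ} (e : Fin n → A) {d : A}
    (hd : d * d = 0) (y : Fin m → Fin n → A) : NilSquareTuple fun i => e + d • y i :=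
  fun i j a b => by
    simp only [Pi.add_apply, Pi.smul_apply, smul_eq_mul]
    linear_combination (y j a - y i a) * (y j b - y i b) * hd

theorem nilSquareTuple_pair {A : Type u} [CommRing A] {x y : Fin n → A} :
    NilSquareTuple ![x, y] ↔ NilSq (y - x) := by
  constructor
  · intro h i j
    exact h 0 1 i j
  · intro h i j a b
    have h' := h a b
    simp only [Pi.sub_apply] at h'
    fin_cases i <;> fin_cases j <;> simp <;> linear_combination h'

theorem InMonad.of_at {P Q : M.obj (op U)} {p x : Fin n → R.obj (op U)} (hP : c.At (𝟙 U) P p)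
    (hx : NilSq x) (hQ : c.At (𝟙 U) Q (p + x)) : InMonad J R n M P Q := by
  refine NilSquareNbrs.of_at (c := c) (x := ![p, p + x]) (fun i => ?_) ?_
  · fin_cases i
    · exact hP
    · exact hQ
  · rw [nilSquareTuple_pair]
    rwa [add_sub_cancel_left]

theorem pair_of_nilSquareTuple {m : ℕ} {P : Fin m → M.obj (op U)}
    {hP : ∀ i, P i ∈ c.carrier (𝟙 U)} (h : NilSquareTuple fun i => c.coord (𝟙 U) _ (hP i))
    (i j : Fin m) : ∃ p x, NilSq x ∧ c.At (𝟙 U) (P i) p ∧ c.At (𝟙 U) (P j) (p + x) :=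
  ⟨c.coord _ _ (hP i), c.coord _ _ (hP j) - c.coord _ _ (hP i), h i j,
    Chart.at_coord _, by rw [add_sub_cancel]; exact Chart.at_coord _⟩

/-- Nil-square neighbours lie in any chart around one of them and are nil-square there. -/
theorem InMonad.exists_at (hR : Presieve.IsSheaf J R) (hI : KockLawvereI R) {P Q : M.obj (op U)}
    (h : InMonad J R n M P Q) {p : Fin n → R.obj (op U)} (hP : c.At (𝟙 U) P p) :
    ∃ x, NilSq x ∧ c.At (𝟙 U) Q (p + x) := by
  have hloc : Locally J U fun W f => ∃ x, NilSq x ∧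
      c.At f (M.map f.op Q) (vecRes f p + x) := by
    refine h.mono fun W f ⟨c', hc', hnil⟩ => ?_
    obtain ⟨q, x, hx, hPq, hQq⟩ := pair_of_nilSquareTuple hnil 0 1
    obtain ⟨A, hA⟩ := Chart.exists_transition (c := c') (c' := c.restrict f) hI hPq
      (Chart.restrict_at_id.2 (hP.map_id f))
    have := hA (𝟙 W) x _ hx (by rw [vecRes_id]; exact hQq)
    rw [Chart.restrict_at_id, vecRes_id] at this
    exact ⟨_, hx.mulVec _, this⟩
  have hQ : Q ∈ c.carrier (𝟙 U) := c.local_mem _ _ <| hloc.mono fun W f ⟨x, _, hx⟩ => by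
    rw [Category.comp_id]; exact hx.1
  refine ⟨c.coord _ _ hQ - p, fun i j => ?_, by rw [add_sub_cancel]; exact Chart.at_coord _⟩
  refine eq_of_locally hR (hloc.mono fun W f ⟨x, hx, hxQ⟩ => ?_)
  have h1 : vecRes f (c.coord _ _ hQ - p) = x := by
    rw [vecRes_sub, ((Chart.at_coord hQ).map_id f).unique hxQ, add_sub_cancel_left]
  rw [scalar_map_mul, scalar_map_zero, ← vecRes_apply, ← vecRes_apply, h1]
  exact hx i j

/-- Affine combinations of two points may be computed in any chart around these points. -/
theorem IsAffineComb.at_of_at (hR : Presieve.IsSheaf J R) (hI : KockLawvereI R)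
    {P Q L : M.obj (op U)} {μ ν : R.obj (op U)} (h : IsAffineComb J R n M ![μ, ν] ![P, Q] L)
    {p q : Fin n → R.obj (op U)} (hP : c.At (𝟙 U) P p) (hQ : c.At (𝟙 U) Q q) :
    c.At (𝟙 U) L (μ • p + ν • q) := by
  obtain ⟨hμ, h⟩ := h
  replace hμ : μ + ν = 1 := by simpa using hμ
  refine Chart.At.of_locally hR (h.mono fun W f ⟨c', hc', hL, hnil, hcomb⟩ => ?_)
  obtain ⟨p', x, hx, hPp, hQp⟩ := pair_of_nilSquareTuple hnil 0 1
  obtain ⟨A, hA⟩ := Chart.exists_transition (c := c') (c' := c.restrict f) hI hPp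
    (Chart.restrict_at_id.2 (hP.map_id f))
  have hQA := hA (𝟙 W) x _ hx (by rw [vecRes_id]; exact hQp)
  -- Since μ + ν = 1, the combination is the base point plus ν times a nil-square difference, and
  -- there the transition function is affine.
  have hLp : c'.At (𝟙 W) (M.map f.op L) (p' + R.map f.op ν • x) := by
    refine ⟨hL, funext fun a => ?_⟩
    rw [hcomb, Fin.sum_univ_two, (hPp.2 : c'.coord _ _ (hc' 0) = _),
      (hQp.2 : c'.coord _ _ (hc' 1) = _)]
    have := congrArg (R.map f.op) hμ
    rw [scalar_map_add, scalar_map_one] at this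
    simp only [Matrix.cons_val_zero, Matrix.cons_val_one, Pi.add_apply, Pi.smul_apply, smul_eq_mul]
    linear_combination p' a * this
  have hLA := hA (𝟙 W) (R.map f.op ν • x) _ (hx.smul _) (by rw [vecRes_id]; exact hLp)
  rw [Chart.restrict_at_id, vecRes_id] at hQA hLA
  rw [Category.comp_id]
  have h2 := hQA.unique (hQ.map_id f)
  rw [Matrix.mulVec_smul] at hLA
  convert hLA using 1
  rw [vecRes_add, vecRes_smul, vecRes_smul, ← h2, smul_add, ← add_assoc, ← add_smul,
    ← scalar_map_add, hμ, scalar_map_one, one_smul]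

end Neighbours

/-! ### The second-order expansion of the multiplication at the neutral element -/

section Multiplication

open scoped commutatorElement

variable {C : Type u} [SmallCategory C] {J : GrothendieckTopology C}
  {R : Cᵒᵖ ⥤ Type u} [InternalAlgebra R] {n : ℕ} {G : Cᵒᵖ ⥤ Type u} [InternalGroup G] {U : C}
  {c : Chart J R n G U}

/-- `γ` is the second-order part of the multiplication in the chart `c` around `e`. -/
def IsProductSymbol (c : Chart J R n G U) (e : Fin n → R.obj (op U))
    (γ : Fin n → Fin n → Fin n → R.obj (op U)) : Prop :=
  ∀ ⦃W : C⦄ (f : W ⟶ U) (I : Ideal (R.obj (op W))) (x y : Fin n → R.obj (op W))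
    (P Q : G.obj (op W)), CubeZero I → (∀ i, x i ∈ I) → (∀ i, y i ∈ I) →
    c.At f P (vecRes f e + x) → c.At f Q (vecRes f e + y) →
    c.At f (P * Q) (vecRes f e + x + y + bilin (fun k i j => R.map f.op (γ k i j)) x y)

/-- By the axiom for D₂(2n), the product is a polynomial of degree at most two in (x, y). Its
restrictions to x = 0 and to y = 0 are fixed by the unit laws, so only the mixed quadratic terms
remain unknown, and these form γ. -/
theorem exists_isProductSymbol (hII : KockLawvereII R) {e : Fin n → R.obj (op U)}
    (he : c.At (𝟙 U) 1 e) : ∃ γ, IsProductSymbol c e γ := by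
  -- The first n coordinates of D₂(2n) move the left factor and the last n the right factor.
  obtain ⟨σ₁, h₁⟩ := c.exists_shift (k := 2) (Or.inr rfl) he (Fin.castAdd n)
  obtain ⟨σ₂, h₂⟩ := c.exists_shift (k := 2) (Or.inr rfl) he (Fin.natAdd n)
  let σ : StageMap (infinitesimals R 2 (n + n)) G U :=
    ⟨fun W f d => σ₁.app f d * σ₂.app f d, fun W W' f g d => by
      rw [group_map_mul, σ₁.naturality, σ₂.naturality]⟩
  have hone : ∀ ⦃W : C⦄ (f : W ⟶ U), c.At f 1 (vecRes f e) := fun W f => by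
    simpa only [group_map_one] using he.map_id f
  have hσ₁ : ∀ ⦃W : C⦄ (f : W ⟶ U) (d : (infinitesimals R 2 (n + n)).obj (op W)),
      (∀ i, d.1 (Fin.castAdd n i) = 0) → σ₁.app f d = 1 := fun W f d hd => by
    have h := h₁ f d
    rw [show (fun i => d.1 (Fin.castAdd n i)) = 0 from funext hd, add_zero] at h
    exact h.inj (hone f)
  have hσ₂ : ∀ ⦃W : C⦄ (f : W ⟶ U) (d : (infinitesimals R 2 (n + n)).obj (op W)),
      (∀ i, d.1 (Fin.natAdd n i) = 0) → σ₂.app f d = 1 := fun W f d hd => by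
    have h := h₂ f d
    rw [show (fun i => d.1 (Fin.natAdd n i)) = 0 from funext hd, add_zero] at h
    exact h.inj (hone f)
  obtain ⟨τ, hτ⟩ := c.exists_coordMap (Or.inr rfl) σ (by
    change σ₁.app _ _ * σ₂.app _ _ ∈ _
    rw [hσ₁ _ _ fun _ => rfl, hσ₂ _ _ fun _ => rfl, mul_one]
    exact he.1)
  obtain ⟨p, A, B, hpoly⟩ := hII.exists_quadratic τ
  -- The quadratic coefficients here are not assumed triangular, so both mixed blocks contribute to
  -- γ.
  refine ⟨fun k i j => B k (Fin.castAdd n i) (Fin.natAdd n j)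
    + B k (Fin.natAdd n j) (Fin.castAdd n i), fun W f I x y P Q hI hx hy hP hQ => ?_⟩
  have hpt : ∀ x y : Fin n → R.obj (op W), (∀ i, x i ∈ I) → (∀ i, y i ∈ I) →
      ∃ d : (infinitesimals R 2 (n + n)).obj (op W), d.1 = Fin.append x y := by
    intro x y hx hy
    have hmem : ∀ i, Fin.append x y i ∈ I := fun i => by
      refine Fin.addCases (fun i => ?_) (fun i => ?_) i
      · rw [Fin.append_left]; exact hx i
      · rw [Fin.append_right]; exact hy i
    refine ⟨⟨Fin.append x y, fun a => ?_⟩, rfl⟩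
    rw [Fin.prod_univ_three]
    exact hI _ (hmem _) _ (hmem _) _ (hmem _)
  have h0 : ∀ i : Fin n, (0 : Fin n → R.obj (op W)) i ∈ I := fun _ => I.zero_mem
  obtain ⟨d, hd⟩ := hpt x y hx hy
  obtain ⟨dx, hdx⟩ := hpt x 0 hx h0
  obtain ⟨dy, hdy⟩ := hpt 0 y h0 hy
  -- The four points (x, y), (x, 0), (0, y), (0, 0) serve to isolate the mixed part of the
  -- polynomial.
  obtain ⟨d0, hd0⟩ := hpt 0 0 h0 h0
  have hval : ∀ (d : (infinitesimals R 2 (n + n)).obj (op W)) (x y : Fin n → R.obj (op W)),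
      d.1 = Fin.append x y → c.At f (σ₁.app f d) (vecRes f e + x) ∧
        c.At f (σ₂.app f d) (vecRes f e + y) := by
    intro d x y hd
    have h1 := h₁ f d
    have h2 := h₂ f d
    simp only [hd, Fin.append_left, Fin.append_right] at h1 h2
    exact ⟨h1, h2⟩
  have hτd : c.At f (P * Q) (τ.vec f d) := by
    have h := hτ f d
    change c.At f (σ₁.app f d * σ₂.app f d) _ at h
    rwa [(hval d x y hd).1.inj hP, (hval d x y hd).2.inj hQ] at h
  have hτx : τ.vec f dx = vecRes f e + x := by
    have h := hτ f dx
    change c.At f (σ₁.app f dx * σ₂.app f dx) _ at h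
    rw [hσ₂ f dx fun i => by rw [hdx, Fin.append_right]; rfl, mul_one] at h
    exact h.unique (hval dx x 0 hdx).1
  have hτy : τ.vec f dy = vecRes f e + y := by
    have h := hτ f dy
    change c.At f (σ₁.app f dy * σ₂.app f dy) _ at h
    rw [hσ₁ f dy fun i => by rw [hdy, Fin.append_left]; rfl, one_mul] at h
    exact h.unique (hval dy 0 y hdy).2
  have hτ0 : τ.vec f d0 = vecRes f e := by
    have h := hτ f d0
    change c.At f (σ₁.app f d0 * σ₂.app f d0) _ at h
    rw [hσ₁ f d0 fun i => by rw [hd0, Fin.append_left]; rfl,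
      hσ₂ f d0 fun i => by rw [hd0, Fin.append_right]; rfl, one_mul] at h
    exact h.unique (hone f)
  convert hτd using 1
  ext k
  have e1 := congrFun hτx k
  have e2 := congrFun hτy k
  have e3 := congrFun hτ0 k
  rw [hpoly] at e1 e2 e3
  rw [hpoly]
  simp only [hd, hdx, hdy, hd0, Fin.sum_univ_add, Fin.append_left, Fin.append_right,
    Pi.zero_apply, mul_zero, zero_mul, Finset.sum_const_zero, add_zero, zero_add, Pi.add_apply,
    bilin, scalar_map_add, add_mul, Finset.sum_add_distrib] at e1 e2 e3 ⊢
  have e4 : ∑ i, ∑ j, R.map f.op (B k (Fin.natAdd n i) (Fin.castAdd n j)) * y i * x j =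
      ∑ i, ∑ j, R.map f.op (B k (Fin.natAdd n j) (Fin.castAdd n i)) * x i * y j := by
    rw [Finset.sum_comm]
    exact Finset.sum_congr rfl fun i _ => Finset.sum_congr rfl fun j _ => by ring
  rw [e4]
  -- Inclusion-exclusion: the value at (x, y), minus those at (x, 0) and (0, y), plus that at (0,
  -- 0), is the mixed part.
  linear_combination e3 - e1 - e2

theorem IsProductSymbol.restrict {e : Fin n → R.obj (op U)}
    {γ : Fin n → Fin n → Fin n → R.obj (op U)} (h : IsProductSymbol c e γ) {W : C} (f : W ⟶ U) :
    IsProductSymbol (c.restrict f) (vecRes f e) (fun k i j => R.map f.op (γ k i j)) := by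
  intro V g I x y P Q hI hx hy hP hQ
  rw [Chart.restrict_at, vecRes_vecRes] at hP hQ ⊢
  simpa only [map_map_op] using h (g ≫ f) I x y P Q hI hx hy hP hQ

/-- In a chart around `e`, products and commutators of points of `𝔐(e)` agree up to second order
with the symbol of the multiplication. -/
theorem IsProductSymbol.mul_at {e : Fin n → R.obj (op U)}
    {γ : Fin n → Fin n → Fin n → R.obj (op U)} (h : IsProductSymbol c e γ) {W : C} {f : W ⟶ U}
    {x y : Fin n → R.obj (op W)} (hx : NilSq x) (hy : NilSq y) {P Q : G.obj (op W)}
    (hP : c.At f P (vecRes f e + x)) (hQ : c.At f Q (vecRes f e + y)) :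
    c.At f (P * Q) (vecRes f e + x + y + bilin (fun k i j => R.map f.op (γ k i j)) x y) := by
  obtain ⟨I, hI, hxI, hyI⟩ := hx.exists_cubeZero hy
  exact h f I x y P Q hI hxI hyI hP hQ

/-- Products of two coordinates have degree four in an ideal where degree three vanishes. -/
theorem bracketCoord_nilSq {A : Type u} [CommRing A] (γ : Fin n → Fin n → Fin n → A)
    {x y : Fin n → A} (hx : NilSq x) (hy : NilSq y) : NilSq (bilin γ x y - bilin γ y x) := by
  obtain ⟨I, hI, hxI, hyI⟩ := hx.exists_cubeZero hy
  intro i j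
  have hm : ∀ j, (bilin γ x y - bilin γ y x) j ∈ I := fun j =>
    I.sub_mem (bilin_mem γ hxI j) (bilin_mem γ hyI j)
  rw [Pi.sub_apply, sub_mul, bilin_mul_eq_zero hI γ hxI hyI (hm j),
    bilin_mul_eq_zero hI γ hyI hxI (hm j), sub_zero]

/-- Instead of expanding inverses, one takes the point K with the claimed coordinates and checks
K(QP) = PQ. The second-order term of this product has degree at least three. -/
theorem IsProductSymbol.commutator_at {e : Fin n → R.obj (op U)}
    {γ : Fin n → Fin n → Fin n → R.obj (op U)} (he : c.At (𝟙 U) 1 e) (h : IsProductSymbol c e γ)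
    {W : C} {f : W ⟶ U} {x y : Fin n → R.obj (op W)} (hx : NilSq x) (hy : NilSq y)
    {P Q : G.obj (op W)} (hP : c.At f P (vecRes f e + x)) (hQ : c.At f Q (vecRes f e + y)) :
    c.At f ⁅P, Q⁆ (vecRes f e + (bilin (fun k i j => R.map f.op (γ k i j)) x y
      - bilin (fun k i j => R.map f.op (γ k i j)) y x)) := by
  obtain ⟨I, hI, hxI, hyI⟩ := hx.exists_cubeZero hy
  set γ' : Fin n → Fin n → Fin n → R.obj (op W) := fun k i j => R.map f.op (γ k i j) with hγ'
  obtain ⟨K, hK⟩ := Chart.exists_at_add he f (bracketCoord_nilSq γ' hx hy)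
  have hPQ := h.mul_at hx hy hP hQ
  have hQP := h.mul_at hy hx hQ hP
  have hzI : ∀ i, (y + x + bilin γ' y x) i ∈ I := fun i =>
    I.add_mem (I.add_mem (hyI i) (hxI i)) (bilin_mem γ' hyI i)
  have hkI : ∀ i, (bilin γ' x y - bilin γ' y x) i ∈ I := fun i =>
    I.sub_mem (bilin_mem γ' hxI i) (bilin_mem γ' hyI i)
  -- QP need not be a nil-square neighbour of e; the product formula applies because it was stated
  -- for all vectors with entries in I.
  have hKQP := h f I _ (y + x + bilin γ' y x) K (Q * P) hI hkI hzI hK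
    (by convert hQP using 1; abel)
  have hzero : bilin γ' (bilin γ' x y - bilin γ' y x) (y + x + bilin γ' y x) = 0 :=
    bilin_eq_zero fun i j => by
      rw [Pi.sub_apply, sub_mul, bilin_mul_eq_zero hI γ' hxI hyI (hzI j),
        bilin_mul_eq_zero hI γ' hyI hxI (hzI j), sub_zero]
  have : K * (Q * P) = P * Q := hKQP.inj (by
    convert hPQ using 1
    rw [← hγ', hzero]
    abel)
  have hcomm : ⁅P, Q⁆ = K := by
    rw [commutatorElement_def, mul_assoc, ← mul_inv_rev, mul_inv_eq_iff_eq_mul, this]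
  rwa [hcomm]

end Multiplication

/-! ### Operations on tangent vectors, defined through the group and reparametrisation -/

section TangentOperations

variable {C : Type u} [SmallCategory C] {R : Cᵒᵖ ⥤ Type u} [InternalAlgebra R]
  {G : Cᵒᵖ ⥤ Type u} [InternalGroup G] {U W : C}

/-- `r d` for `r` in `R` and `d` in `D`. -/
def disc.smul (r : R.obj (op U)) (d : (disc R).obj (op U)) : (disc R).obj (op U) :=
  ⟨r * d.1, by rw [mul_mul_mul_comm, d.2, mul_zero]⟩

theorem disc.map_smul (f : W ⟶ U) (r : R.obj (op U)) (d : (disc R).obj (op U)) :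
    (disc R).map f.op (disc.smul r d) = disc.smul (R.map f.op r) ((disc R).map f.op d) :=
  Subtype.ext (scalar_map_mul f _ _)

theorem disc.smul_zero (r : R.obj (op U)) : disc.smul r (disc.zero R U) = disc.zero R U :=
  Subtype.ext (mul_zero r)

theorem disc.map_mul (f : W ⟶ U) (d₁ d₂ : (disc R).obj (op U)) :
    (disc R).map f.op (disc.mul d₁ d₂) = disc.mul ((disc R).map f.op d₁) ((disc R).map f.op d₂) :=
  Subtype.ext (scalar_map_mul f _ _)

theorem disc.mul_comm (d₁ d₂ : (disc R).obj (op U)) : disc.mul d₁ d₂ = disc.mul d₂ d₁ :=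
  Subtype.ext (_root_.mul_comm _ _)

namespace tangentSpace

/-- The pointwise sum of tangent vectors is their pointwise product. -/
def add (s t : (tangentSpace R G).obj (op U)) : (tangentSpace R G).obj (op U) :=
  mk (fun _ f d => s.1.app f d * t.1.app f d)
    (fun _ _ f g d => by rw [group_map_mul, s.1.naturality, t.1.naturality])
    (fun _ f => by rw [app_zero, app_zero, mul_one])

/-- The constant tangent vector. -/
def zero : (tangentSpace R G).obj (op U) :=
  mk (fun _ _ _ => 1) (fun _ _ _ g _ => group_map_one g) (fun _ _ => rfl)

/-- The pointwise inverse of a tangent vector. -/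
def neg (t : (tangentSpace R G).obj (op U)) : (tangentSpace R G).obj (op U) :=
  mk (fun _ f d => (t.1.app f d)⁻¹)
    (fun _ _ f g d => by rw [group_map_inv, t.1.naturality])
    (fun _ f => by rw [app_zero, inv_one])

/-- The tangent vector `d ↦ t (r d)`. -/
def smul (r : R.obj (op U)) (t : (tangentSpace R G).obj (op U)) :
    (tangentSpace R G).obj (op U) :=
  mk (fun _ f d => t.1.app f (disc.smul (R.map f.op r) d))
    (fun _ _ f g d => by rw [t.1.naturality, disc.map_smul, map_map_op])
    (fun _ f => by rw [disc.smul_zero, app_zero])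

theorem add_app (s t : (tangentSpace R G).obj (op U)) (f : W ⟶ U) (d : (disc R).obj (op W)) :
    (add s t).1.app f d = s.1.app f d * t.1.app f d := rfl

theorem zero_app (f : W ⟶ U) (d : (disc R).obj (op W)) :
    (zero : (tangentSpace R G).obj (op U)).1.app f d = 1 := rfl

theorem smul_app (r : R.obj (op U)) (t : (tangentSpace R G).obj (op U)) (f : W ⟶ U)
    (d : (disc R).obj (op W)) :
    (smul r t).1.app f d = t.1.app f (disc.smul (R.map f.op r) d) := rfl

theorem map_smul (f : W ⟶ U) (r : R.obj (op U)) (t : (tangentSpace R G).obj (op U)) :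
    (tangentSpace R G).map f.op (smul r t) =
      smul (R.map f.op r) ((tangentSpace R G).map f.op t) := by
  ext V g d
  rw [map_app, smul_app, smul_app, map_app, map_map_op]

end tangentSpace

end TangentOperations

/-! ### The Lie algebra structure on the tangent space -/

section LieGroup

open tangentSpace
open scoped commutatorElement

variable {C : Type u} [SmallCategory C] {J : GrothendieckTopology C}
  {R : Cᵒᵖ ⥤ Type u} [InternalAlgebra R] {n : ℕ} {G : Cᵒᵖ ⥤ Type u} [InternalGroup G] {U W : C}
  {c : Chart J R n G U} {e : Fin n → R.obj (op U)}

/-- `a` is the principal part of the tangent vector `t` in the chart `c`. -/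
def IsPrincipalPart (c : Chart J R n G U) (e : Fin n → R.obj (op U))
    (t : (tangentSpace R G).obj (op U)) (a : Fin n → R.obj (op U)) : Prop :=
  ∀ ⦃W : C⦄ (f : W ⟶ U) (d : (disc R).obj (op W)),
    c.At f (t.1.app f d) (vecRes f e + d.1 • vecRes f a)

theorem IsPrincipalPart.restrict {t : (tangentSpace R G).obj (op U)} {a : Fin n → R.obj (op U)}
    (h : IsPrincipalPart c e t a) (f : W ⟶ U) :
    IsPrincipalPart (c.restrict f) (vecRes f e) ((tangentSpace R G).map f.op t) (vecRes f a) := by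
  intro V g d
  rw [Chart.restrict_at, vecRes_vecRes, vecRes_vecRes]
  exact h (g ≫ f) d

theorem IsPrincipalPart.inj {s t : (tangentSpace R G).obj (op U)} {a : Fin n → R.obj (op U)}
    (hs : IsPrincipalPart c e s a) (ht : IsPrincipalPart c e t a) : s = t :=
  tangentSpace.ext fun _ f d => (hs f d).inj (ht f d)

theorem IsPrincipalPart.unique (hI : KockLawvereI R) {t : (tangentSpace R G).obj (op U)}
    {a b : Fin n → R.obj (op U)} (ha : IsPrincipalPart c e t a) (hb : IsPrincipalPart c e t b) :
    a = b :=
  hI.cancel_disc fun _ f d => add_left_cancel ((ha f d).unique (hb f d))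

/-- Formal openness keeps t inside the chart, and there the Kock-Lawvere axiom makes it affine in d.
-/
theorem exists_isPrincipalPart (hI : KockLawvereI R) (he : c.At (𝟙 U) 1 e)
    (t : (tangentSpace R G).obj (op U)) : ∃ a, IsPrincipalPart c e t a := by
  let σ : StageMap (infinitesimals R 1 1) G U :=
    ⟨fun _ f d => t.1.app f (infinitesimals.toDisc d),
      fun _ _ f g d => t.1.naturality f g (infinitesimals.toDisc d)⟩
  have h0 : σ.app (𝟙 U) (infinitesimals.origin R 1 1 U) ∈ c.carrier (𝟙 U) := by
    have : σ.app (𝟙 U) (infinitesimals.origin R 1 1 U) = 1 := t.2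
    rw [this]
    exact he.1
  obtain ⟨τ, hτ⟩ := c.exists_coordMap (Or.inl rfl) σ h0
  obtain ⟨a, ha⟩ := hI.exists_slope (StageMap.ofVec (X := disc R)
    (fun _ f d => τ.vec f (disc.toInfinitesimals d))
    (fun _ _ f g d => τ.vec_naturality f g (disc.toInfinitesimals d)))
  refine ⟨a, fun W f d => ?_⟩
  have h1 : c.At f (t.1.app f d) (τ.vec f (disc.toInfinitesimals d)) :=
    hτ f (disc.toInfinitesimals d)
  have h2 : c.At f (t.1.app f (disc.zero R W)) (τ.vec f (disc.toInfinitesimals (disc.zero R W))) :=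
    hτ f (disc.toInfinitesimals (disc.zero R W))
  rw [app_zero] at h2
  have h3 := he.map_id f
  rw [group_map_one] at h3
  have h4 := ha f d
  change τ.vec f _ = τ.vec f _ + _ at h4
  rwa [h4, h2.unique h3] at h1

theorem exists_of_principalPart (he : c.At (𝟙 U) 1 e) (a : Fin n → R.obj (op U)) :
    ∃ t : (tangentSpace R G).obj (op U), IsPrincipalPart c e t a := by
  choose t ht using fun (W : C) (f : W ⟶ U) (d : (disc R).obj (op W)) =>
    Chart.exists_at_add he f (NilSq.smul_of_mul_self d.2 (vecRes f a))
  refine ⟨mk (fun W f d => t W f d) (fun W V f g d => ?_) (fun W f => ?_), ht⟩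
  · have h := (ht W f d).map g
    rw [vecRes_add, vecRes_smul, vecRes_vecRes, vecRes_vecRes] at h
    exact h.inj (ht V (g ≫ f) ((disc R).map g.op d))
  · have h := ht W f (disc.zero R W)
    rw [show (disc.zero R W).1 = 0 from rfl, zero_smul, add_zero] at h
    have h3 := he.map_id f
    rw [group_map_one] at h3
    exact h.inj h3

/-- The second-order term of the product t(d)s(d) carries the factor d² = 0; so the product in G
realises vector addition. -/
theorem IsPrincipalPart.add (hII : KockLawvereII R) (he : c.At (𝟙 U) 1 e)
    {s t : (tangentSpace R G).obj (op U)} {a b : Fin n → R.obj (op U)}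
    (hs : IsPrincipalPart c e s a) (ht : IsPrincipalPart c e t b) :
    IsPrincipalPart c e (add s t) (a + b) := by
  obtain ⟨γ, hγ⟩ := exists_isProductSymbol hII he
  intro W f d
  have h := hγ.mul_at (NilSq.smul_of_mul_self d.2 _) (NilSq.smul_of_mul_self d.2 _) (hs f d) (ht f d)
  rw [bilin_smul_left, bilin_smul_right, smul_smul, d.2, zero_smul, add_zero, add_assoc,
    ← smul_add, ← vecRes_add] at h
  exact h

theorem IsPrincipalPart.smul {t : (tangentSpace R G).obj (op U)} {a : Fin n → R.obj (op U)}
    (ht : IsPrincipalPart c e t a) (r : R.obj (op U)) :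
    IsPrincipalPart c e (smul r t) (r • a) := by
  intro W f d
  have h := ht f (disc.smul (R.map f.op r) d)
  rw [show (disc.smul (R.map f.op r) d).1 = d.1 * R.map f.op r from mul_comm _ _, mul_smul,
    ← vecRes_smul] at h
  exact h

/-- `w` is the bracket of `s` and `t`: `w(d₁ d₂)` is the group commutator of `s(d₁)` and
`t(d₂)`. -/
def IsTangentBracket (s t w : (tangentSpace R G).obj (op U)) : Prop :=
  ∀ ⦃W : C⦄ (f : W ⟶ U) (d₁ d₂ : (disc R).obj (op W)),
    w.1.app f (disc.mul d₁ d₂) = ⁅s.1.app f d₁, t.1.app f d₂⁆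

theorem IsTangentBracket.map {s t w : (tangentSpace R G).obj (op U)}
    (h : IsTangentBracket s t w) (f : W ⟶ U) :
    IsTangentBracket ((tangentSpace R G).map f.op s) ((tangentSpace R G).map f.op t)
      ((tangentSpace R G).map f.op w) :=
  fun _ g d₁ d₂ => h (g ≫ f) d₁ d₂

theorem IsTangentBracket.of_locally (hG : Presieve.IsSheaf J G)
    {s t w : (tangentSpace R G).obj (op U)}
    (h : Locally J U fun _ f => IsTangentBracket ((tangentSpace R G).map f.op s)
      ((tangentSpace R G).map f.op t) ((tangentSpace R G).map f.op w)) :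
    IsTangentBracket s t w := by
  refine fun W f d₁ d₂ => eq_of_locally hG ((h.pullback f).mono fun V g hg => ?_)
  have := hg (𝟙 V) ((disc R).map g.op d₁) ((disc R).map g.op d₂)
  simp only [map_app, Category.id_comp] at this
  rw [w.1.naturality, disc.map_mul, this, commutatorElement_def, commutatorElement_def,
    group_map_mul, group_map_mul, group_map_mul, group_map_inv, group_map_inv, s.1.naturality,
    t.1.naturality]

/-- With x = d₁a and y = d₂b, bilinearity pulls d₁d₂ out of the coordinates of the commutator. -/
theorem IsPrincipalPart.isTangentBracket (he : c.At (𝟙 U) 1 e)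
    {γ : Fin n → Fin n → Fin n → R.obj (op U)} (hγ : IsProductSymbol c e γ)
    {s t w : (tangentSpace R G).obj (op U)} {a b : Fin n → R.obj (op U)}
    (hs : IsPrincipalPart c e s a) (ht : IsPrincipalPart c e t b)
    (hw : IsPrincipalPart c e w (bilin γ a b - bilin γ b a)) : IsTangentBracket s t w := by
  intro W f d₁ d₂
  have h := hγ.commutator_at he (NilSq.smul_of_mul_self d₁.2 _) (NilSq.smul_of_mul_self d₂.2 _)
    (hs f d₁) (ht f d₂)
  refine (hw f _).inj ?_
  convert h using 2
  rw [vecRes_sub, vecRes_bilin, vecRes_bilin, bilin_smul_left, bilin_smul_right, bilin_smul_left,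
    bilin_smul_right, smul_smul, smul_smul, mul_comm d₂.1, ← smul_sub]
  rfl

/-- The Kock-Lawvere axioms hold for the sheaf `R`, and `G` is a Lie group of dimension `n`. -/
structure IsLieGroup (J : GrothendieckTopology C) (R : Cᵒᵖ ⥤ Type u) [InternalAlgebra R] (n : ℕ)
    (G : Cᵒᵖ ⥤ Type u) [InternalGroup G] : Prop where
  scalar_isSheaf : Presieve.IsSheaf J R
  kockLawvereI : KockLawvereI R
  kockLawvereII : KockLawvereII R
  isFormalManifold : IsFormalManifold J R n G

namespace IsLieGroup

theorem tangent_isSheaf (H : IsLieGroup J R n G) : Presieve.IsSheaf J (tangentSpace R G) :=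
  tangentSpace.isSheaf H.isFormalManifold.1

theorem exists_chart (H : IsLieGroup J R n G) (U : C) :
    Locally J U fun W _ => ∃ (c : Chart J R n G W) (e : Fin n → R.obj (op W)), c.At (𝟙 W) 1 e :=
  (H.isFormalManifold.2 U 1).mono fun W f ⟨c, hc⟩ => ⟨c, _, by
    rw [← group_map_one f]; exact Chart.at_coord hc⟩

theorem tangent_ext (H : IsLieGroup J R n G) {s t : (tangentSpace R G).obj (op U)}
    (h : ∀ ⦃W : C⦄ (f : W ⟶ U) (c : Chart J R n G W) (e : Fin n → R.obj (op W)),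
      c.At (𝟙 W) 1 e → (tangentSpace R G).map f.op s = (tangentSpace R G).map f.op t) : s = t :=
  eq_of_locally H.tangent_isSheaf ((H.exists_chart U).mono fun _ f ⟨c, e, he⟩ => h f c e he)

/-- A tangent vector is determined by its values at products. -/
theorem tangent_ext_mul (H : IsLieGroup J R n G) {s t : (tangentSpace R G).obj (op U)}
    (h : ∀ ⦃W : C⦄ (f : W ⟶ U) (d₁ d₂ : (disc R).obj (op W)),
      s.1.app f (disc.mul d₁ d₂) = t.1.app f (disc.mul d₁ d₂)) : s = t := by
  refine H.tangent_ext fun W f c e he => ?_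
  obtain ⟨a, ha⟩ := exists_isPrincipalPart H.kockLawvereI he ((tangentSpace R G).map f.op s)
  obtain ⟨b, hb⟩ := exists_isPrincipalPart H.kockLawvereI he ((tangentSpace R G).map f.op t)
  have hab : a = b := by
    refine H.kockLawvereI.cancel_disc_mul fun V g d₁ d₂ => ?_
    have h1 := ha g (disc.mul d₁ d₂)
    have h2 := hb g (disc.mul d₁ d₂)
    rw [map_app, h, ← map_app] at h1
    exact add_left_cancel (h1.unique h2)
  rw [← hab] at hb
  exact ha.inj hb

/-- Three factors are needed for the Jacobi identity and for uniqueness of the bilinear extension;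
one factor is absorbed into the tangent vector as a scalar. -/
theorem tangent_ext_mul_mul (H : IsLieGroup J R n G) {s t : (tangentSpace R G).obj (op U)}
    (h : ∀ ⦃W : C⦄ (f : W ⟶ U) (d₁ d₂ d₃ : (disc R).obj (op W)),
      s.1.app f (disc.mul (disc.mul d₁ d₂) d₃) = t.1.app f (disc.mul (disc.mul d₁ d₂) d₃)) :
    s = t := by
  refine H.tangent_ext_mul fun W f d₁ d₂ => ?_
  have : tangentSpace.smul d₁.1 ((tangentSpace R G).map f.op s) =
      tangentSpace.smul d₁.1 ((tangentSpace R G).map f.op t) := by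
    refine H.tangent_ext_mul fun V g d₂ d₃ => ?_
    have := h (g ≫ f) ((disc R).map g.op d₁) d₂ d₃
    rw [show disc.mul (disc.mul ((disc R).map g.op d₁) d₂) d₃ =
      disc.smul (R.map g.op d₁.1) (disc.mul d₂ d₃) from Subtype.ext (mul_assoc _ _ _)] at this
    exact this
  have h' := congrArg (fun v => v.1.app (𝟙 W) d₂) this
  simp only [smul_app, map_app, map_id_op, Category.id_comp] at h'
  exact h'

/-- A chart, and hence γ, is available only locally. The characterisation through commutators is
chart-free and has at most one solution, so the local solutions glue. -/
theorem existsUnique_isTangentBracket (H : IsLieGroup J R n G) (s t : (tangentSpace R G).obj (op U)) :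
    ∃! w, IsTangentBracket s t w := by
  have huniq : ∀ ⦃W : C⦄ (s t w w' : (tangentSpace R G).obj (op W)), IsTangentBracket s t w →
      IsTangentBracket s t w' → w = w' := fun W s t w w' h h' =>
    H.tangent_ext_mul fun V f d₁ d₂ => (h f d₁ d₂).trans (h' f d₁ d₂).symm
  obtain ⟨w, hw⟩ := exists_of_locally_existsUnique (J := J) H.tangent_isSheaf
    (fun W f w => IsTangentBracket ((tangentSpace R G).map f.op s)
      ((tangentSpace R G).map f.op t) w)
    (fun W V f g w hw => by
      have := hw.map g
      rwa [map_map_op, map_map_op] at this)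
    (fun W f w w' => huniq _ _ w w')
    ((H.exists_chart U).mono fun W f ⟨c, e, he⟩ => by
      obtain ⟨a, ha⟩ := exists_isPrincipalPart H.kockLawvereI he ((tangentSpace R G).map f.op s)
      obtain ⟨b, hb⟩ := exists_isPrincipalPart H.kockLawvereI he ((tangentSpace R G).map f.op t)
      obtain ⟨γ, hγ⟩ := exists_isProductSymbol H.kockLawvereII he
      obtain ⟨w, hw⟩ := exists_of_principalPart he (bilin γ a b - bilin γ b a)
      exact ⟨w, ha.isTangentBracket he hγ hb hw⟩)
  have hw' := IsTangentBracket.of_locally H.isFormalManifold.1 hw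
  exact ⟨w, hw', fun w' h => huniq _ _ _ _ h hw'⟩

/-- The Lie bracket of tangent vectors at the neutral element. -/
noncomputable def bracket (H : IsLieGroup J R n G) (s t : (tangentSpace R G).obj (op U)) :
    (tangentSpace R G).obj (op U) :=
  (H.existsUnique_isTangentBracket s t).choose

theorem bracket_spec (H : IsLieGroup J R n G) (s t : (tangentSpace R G).obj (op U)) :
    IsTangentBracket s t (H.bracket s t) :=
  (H.existsUnique_isTangentBracket s t).choose_spec.1

theorem bracket_eq (H : IsLieGroup J R n G) {s t w : (tangentSpace R G).obj (op U)}
    (h : IsTangentBracket s t w) : H.bracket s t = w :=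
  ((H.existsUnique_isTangentBracket s t).choose_spec.2 w h).symm

theorem map_bracket (H : IsLieGroup J R n G) (f : W ⟶ U) (s t : (tangentSpace R G).obj (op U)) :
    (tangentSpace R G).map f.op (H.bracket s t) =
      H.bracket ((tangentSpace R G).map f.op s) ((tangentSpace R G).map f.op t) :=
  (H.bracket_eq ((H.bracket_spec s t).map f)).symm

/-- G need not be commutative; commutativity is visible only on principal parts, where the
noncommuting term has disappeared. -/
theorem add_comm (H : IsLieGroup J R n G) (s t : (tangentSpace R G).obj (op U)) :
    add s t = add t s := by
  refine H.tangent_ext fun W f c e he => ?_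
  obtain ⟨a, ha⟩ := exists_isPrincipalPart H.kockLawvereI he ((tangentSpace R G).map f.op s)
  obtain ⟨b, hb⟩ := exists_isPrincipalPart H.kockLawvereI he ((tangentSpace R G).map f.op t)
  have h := hb.add H.kockLawvereII he ha
  rw [_root_.add_comm] at h
  exact (ha.add H.kockLawvereII he hb).inj h

/-- Apart from commutativity of addition, this is the only module law that is not formal: t((r +
s)d) = t(rd)t(sd) is seen in a chart. -/
theorem add_smul (H : IsLieGroup J R n G) (r s : R.obj (op U))
    (t : (tangentSpace R G).obj (op U)) : smul (r + s) t = add (smul r t) (smul s t) := by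
  refine H.tangent_ext fun W f c e he => ?_
  obtain ⟨a, ha⟩ := exists_isPrincipalPart H.kockLawvereI he ((tangentSpace R G).map f.op t)
  have h := ha.smul (R.map f.op (r + s))
  rw [scalar_map_add, _root_.add_smul, ← scalar_map_add, ← tangentSpace.map_smul] at h
  refine h.inj ?_
  have h' := (ha.smul (R.map f.op r)).add H.kockLawvereII he (ha.smul (R.map f.op s))
  rw [← tangentSpace.map_smul, ← tangentSpace.map_smul] at h'
  exact h'

/-- `T_e G` is an abelian group. -/
@[reducible]
def addCommGroup (H : IsLieGroup J R n G) (U : Cᵒᵖ) : AddCommGroup ((tangentSpace R G).obj U) where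
  add s t := tangentSpace.add (U := U.unop) s t
  zero := tangentSpace.zero (U := U.unop)
  neg t := tangentSpace.neg (U := U.unop) t
  nsmul := @nsmulRec _ ⟨tangentSpace.zero (U := U.unop)⟩ ⟨tangentSpace.add (U := U.unop)⟩
  zsmul := @zsmulRec _ ⟨tangentSpace.zero (U := U.unop)⟩ ⟨tangentSpace.add (U := U.unop)⟩
    ⟨tangentSpace.neg (U := U.unop)⟩
    (@nsmulRec _ ⟨tangentSpace.zero (U := U.unop)⟩ ⟨tangentSpace.add (U := U.unop)⟩)
  add_assoc _ _ _ := tangentSpace.ext fun _ _ _ => mul_assoc _ _ _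
  zero_add _ := tangentSpace.ext fun _ _ _ => one_mul _
  add_zero _ := tangentSpace.ext fun _ _ _ => mul_one _
  neg_add_cancel _ := tangentSpace.ext fun _ _ _ => inv_mul_cancel _
  add_comm s t := H.add_comm (U := U.unop) s t

/-- `T_e G` is an `R`-module. -/
@[reducible]
def module (H : IsLieGroup J R n G) (U : Cᵒᵖ) :
    @Module (R.obj U) ((tangentSpace R G).obj U) _ (H.addCommGroup U).toAddCommMonoid :=
  letI := H.addCommGroup U
  { smul := fun r t => tangentSpace.smul (U := U.unop) r t
    one_smul := fun t => by
      refine tangentSpace.ext (U := U.unop) fun W f d => ?_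
      change t.1.app f (disc.smul (R.map f.op 1) d) = t.1.app f d
      rw [scalar_map_one]
      congr 1
      exact Subtype.ext (one_mul _)
    mul_smul := fun r s t => by
      refine tangentSpace.ext (U := U.unop) fun W f d => ?_
      change t.1.app f (disc.smul (R.map f.op (r * s)) d) =
        t.1.app f (disc.smul (R.map f.op s) (disc.smul (R.map f.op r) d))
      rw [scalar_map_mul]
      congr 1
      exact Subtype.ext (by
        change R.map f.op r * R.map f.op s * d.1 = R.map f.op s * (R.map f.op r * d.1)
        ring)
    smul_zero := fun r => tangentSpace.ext (U := U.unop) fun _ _ _ => rfl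
    smul_add := fun r s t => tangentSpace.ext (U := U.unop) fun _ _ _ => rfl
    add_smul := fun r s t => H.add_smul (U := U.unop) r s t
    zero_smul := fun t => by
      refine tangentSpace.ext (U := U.unop) fun W f d => ?_
      change t.1.app f (disc.smul (R.map f.op 0) d) = 1
      rw [scalar_map_zero, ← tangentSpace.app_zero (U := U.unop) t f]
      congr 1
      exact Subtype.ext (zero_mul _) }

/-- The identity [xy, z] = x[y, z]x⁻¹[x, z] becomes additive as soon as x = s(d₁) commutes with [y,
z]. The terms then come in reversed order, hence the initial use of commutativity. -/
theorem bracket_add_left (H : IsLieGroup J R n G) (s s' t : (tangentSpace R G).obj (op U)) :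
    H.bracket (add s s') t = add (H.bracket s t) (H.bracket s' t) := by
  rw [H.add_comm (H.bracket s t)]
  refine H.bracket_eq fun W f d₁ d₂ => ?_
  have h1 := H.bracket_spec s t f d₁ d₂
  have h2 := H.bracket_spec s' t f d₁ d₂
  -- The commutator of s(d₁) with [s', t](d₁d₂) is the value of a tangent vector at d₁²d₂ = 0, hence
  -- trivial.
  have h3 := H.bracket_spec s (H.bracket s' t) f d₁ (disc.mul d₁ d₂)
  rw [show disc.mul d₁ (disc.mul d₁ d₂) = disc.zero R W from Subtype.ext (by
    change d₁.1 * (d₁.1 * d₂.1) = 0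
    rw [← mul_assoc, d₁.2, zero_mul]), app_zero, eq_comm, commutatorElement_eq_one_iff_mul_comm,
    h2] at h3
  rw [add_app, add_app, h1, h2]
  have h4 : ∀ x y z : G.obj (op W), x * ⁅y, z⁆ = ⁅y, z⁆ * x → ⁅y, z⁆ * ⁅x, z⁆ = ⁅x * y, z⁆ := by
    intro x y z h
    have : ⁅x * y, z⁆ = x * ⁅y, z⁆ * x⁻¹ * ⁅x, z⁆ := by
      simp only [commutatorElement_def]
      group
    rw [this, h, mul_inv_cancel_right]
  exact h4 _ _ _ h3

/-- Antisymmetry is the rule [x, y]⁻¹ = [y, x] for group commutators. -/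
theorem bracket_add_bracket_swap (H : IsLieGroup J R n G) (s t : (tangentSpace R G).obj (op U)) :
    add (H.bracket s t) (H.bracket t s) = zero := by
  refine H.tangent_ext_mul fun W f d₁ d₂ => ?_
  have h := H.bracket_spec t s f d₂ d₁
  rw [disc.mul_comm] at h
  rw [add_app, zero_app, H.bracket_spec s t f d₁ d₂, h, ← commutatorElement_inv, inv_mul_cancel]

theorem bracket_smul_right (H : IsLieGroup J R n G) (r : R.obj (op U))
    (s t : (tangentSpace R G).obj (op U)) :
    H.bracket s (smul r t) = smul r (H.bracket s t) := by
  refine H.bracket_eq fun W f d₁ d₂ => ?_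
  rw [smul_app, smul_app, ← H.bracket_spec s t]
  congr 1
  exact Subtype.ext (mul_left_comm _ _ _)

/-- Jacobi identity, by the Hall-Witt identity. -/
theorem jacobi (H : IsLieGroup J R n G) (s t v : (tangentSpace R G).obj (op U)) :
    add (add (H.bracket (H.bracket s t) v) (H.bracket (H.bracket t v) s))
      (H.bracket (H.bracket v s) t) = zero := by
  refine H.tangent_ext_mul_mul fun W f d₁ d₂ d₃ => ?_
  -- The Hall-Witt identity involves yzy⁻¹ = [y, z]z in place of z. The extra factor [y, z] is
  -- harmless: it commutes with [x, y] and with [[x, y], z], as both commutators are values at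
  -- multiples of d₂² = 0.
  have key : ∀ (s t v : (tangentSpace R G).obj (op U)) (d₁ d₂ d₃ : (disc R).obj (op W)),
      (H.bracket (H.bracket s t) v).1.app f (disc.mul (disc.mul d₁ d₂) d₃) =
        ⁅⁅s.1.app f d₁, t.1.app f d₂⁆, t.1.app f d₂ * v.1.app f d₃ * (t.1.app f d₂)⁻¹⁆ := by
    intro s t v d₁ d₂ d₃
    have h1 := H.bracket_spec (H.bracket s t) (H.bracket t v) f (disc.mul d₁ d₂) (disc.mul d₂ d₃)
    have h2 := H.bracket_spec (H.bracket t v) (H.bracket (H.bracket s t) v) f (disc.mul d₂ d₃)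
      (disc.mul (disc.mul d₁ d₂) d₃)
    rw [show disc.mul (disc.mul d₁ d₂) (disc.mul d₂ d₃) = disc.zero R W from Subtype.ext (by
      change d₁.1 * d₂.1 * (d₂.1 * d₃.1) = 0
      linear_combination d₁.1 * d₃.1 * d₂.2), app_zero, eq_comm,
      H.bracket_spec s t f d₁ d₂, H.bracket_spec t v f d₂ d₃] at h1
    rw [show disc.mul (disc.mul d₂ d₃) (disc.mul (disc.mul d₁ d₂) d₃) = disc.zero R W from
      Subtype.ext (by
        change d₂.1 * d₃.1 * (d₁.1 * d₂.1 * d₃.1) = 0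
        linear_combination d₁.1 * d₃.1 * d₃.1 * d₂.2), app_zero, eq_comm,
      H.bracket_spec (H.bracket s t) v f (disc.mul d₁ d₂) d₃,
      H.bracket_spec s t f d₁ d₂, H.bracket_spec t v f d₂ d₃,
      commutatorElement_eq_one_iff_mul_comm] at h2
    rw [H.bracket_spec (H.bracket s t) v f (disc.mul d₁ d₂) d₃, H.bracket_spec s t f d₁ d₂]
    have h3 : ∀ x y z : G.obj (op W), ⁅⁅x, y⁆, ⁅y, z⁆⁆ = 1 →
        ⁅y, z⁆ * ⁅⁅x, y⁆, z⁆ = ⁅⁅x, y⁆, z⁆ * ⁅y, z⁆ → ⁅⁅x, y⁆, z⁆ = ⁅⁅x, y⁆, y * z * y⁻¹⁆ := by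
      intro x y z h h'
      have : ⁅⁅x, y⁆, y * z * y⁻¹⁆ = ⁅⁅x, y⁆, ⁅y, z⁆⁆ * (⁅y, z⁆ * ⁅⁅x, y⁆, z⁆ * ⁅y, z⁆⁻¹) := by
        simp only [commutatorElement_def]
        group
      rw [this, h, h', one_mul, mul_inv_cancel_right]
    exact h3 _ _ _ h1 h2
  -- The product d₁d₂d₃ is rotated cyclically so that each summand takes the form required by the
  -- Hall-Witt identity.
  rw [add_app, add_app, zero_app, key s t v,
    show disc.mul (disc.mul d₁ d₂) d₃ = disc.mul (disc.mul d₂ d₃) d₁ from Subtype.ext (by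
      change d₁.1 * d₂.1 * d₃.1 = d₂.1 * d₃.1 * d₁.1
      ring), key t v s,
    show disc.mul (disc.mul d₂ d₃) d₁ = disc.mul (disc.mul d₃ d₁) d₂ from Subtype.ext (by
      change d₂.1 * d₃.1 * d₁.1 = d₃.1 * d₁.1 * d₂.1
      ring), key v s t]
  simp only [commutatorElement_def]
  group

/-- The Lie ring structure on `T_e G`. -/
@[reducible]
noncomputable def lieRing (H : IsLieGroup J R n G) (U : Cᵒᵖ) : LieRing ((tangentSpace R G).obj U) :=
  letI := H.addCommGroup U
  letI := H.module U
  have hadd : ∀ s s' t : (tangentSpace R G).obj U, H.bracket (U := U.unop) (s + s') t =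
    H.bracket (U := U.unop) s t + H.bracket (U := U.unop) s' t :=
    fun s s' t => H.bracket_add_left (U := U.unop) s s' t
  have hswap : ∀ s t : (tangentSpace R G).obj U, H.bracket (U := U.unop) s t =
    -H.bracket (U := U.unop) t s :=
    fun s t => eq_neg_of_add_eq_zero_left (H.bracket_add_bracket_swap (U := U.unop) s t)
  have hneg : ∀ s t : (tangentSpace R G).obj U, H.bracket (U := U.unop) (-s) t =
    -H.bracket (U := U.unop) s t := fun s t => by
      -- Additivity alone gives [0, t] = 0, from which compatibility with negation follows.
      have h0 := hadd 0 0 t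
      rw [add_zero, left_eq_add] at h0
      rw [eq_neg_iff_add_eq_zero, ← hadd, neg_add_cancel, h0]
  { bracket := fun s t => H.bracket (U := U.unop) s t
    add_lie := hadd
    lie_add := fun s t t' => by
      change H.bracket (U := U.unop) s (t + t') =
        H.bracket (U := U.unop) s t + H.bracket (U := U.unop) s t'
      rw [hswap, hadd, neg_add, ← hswap, ← hswap]
    lie_self := fun s => by
      change H.bracket (U := U.unop) s s = 0
      have h : H.bracket (U := U.unop) s s + H.bracket (U := U.unop) s s = 0 :=
        H.bracket_add_bracket_swap (U := U.unop) s s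
      -- Antisymmetry gives only 2[s, s] = 0; invertibility of 2 yields [s, s] = 0.
      have h2 : algebraMap ℚ (R.obj U) (1 / 2) + algebraMap ℚ (R.obj U) (1 / 2) = 1 := by
        rw [← _root_.map_add]
        norm_num
      rw [← one_smul (R.obj U) (H.bracket (U := U.unop) s s), ← h2, _root_.add_smul,
        ← smul_add, h, smul_zero]
    leibniz_lie := fun s t v => by
      change H.bracket (U := U.unop) s (H.bracket (U := U.unop) t v) =
        H.bracket (U := U.unop) (H.bracket (U := U.unop) s t) v +
          H.bracket (U := U.unop) t (H.bracket (U := U.unop) s v)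
      have h : H.bracket (U := U.unop) (H.bracket (U := U.unop) s t) v +
        H.bracket (U := U.unop) (H.bracket (U := U.unop) t v) s +
        H.bracket (U := U.unop) (H.bracket (U := U.unop) v s) t = 0 :=
        H.jacobi (U := U.unop) s t v
      rw [hswap s (H.bracket (U := U.unop) t v), hswap t (H.bracket (U := U.unop) s v),
        hswap s v, hneg, neg_neg, neg_eq_iff_add_eq_zero, ← h]
      abel }

/-- The internal Lie ring structure on `T_e G`. -/
@[reducible]
noncomputable def internalLieRing (H : IsLieGroup J R n G) :
    InternalLieRing (tangentSpace R G) where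
  lieRing U := H.lieRing U
  map_add _ _ _ := rfl
  map_lie f s t := H.map_bracket f.unop s t

/-- The internal Lie algebra structure on `T_e G`. -/
@[reducible]
noncomputable def internalLieAlgebra (H : IsLieGroup J R n G) :
    @InternalLieAlgebra C _ R _ (tangentSpace R G) H.internalLieRing :=
  letI := H.internalLieRing
  { lieAlgebra := fun U =>
      { H.module U with
        lie_smul := fun r s t => H.bracket_smul_right (U := U.unop) r s t }
    map_smul := fun f r t => tangentSpace.map_smul f.unop r t }

end IsLieGroup

end LieGroup

/-! ### Second-order logarithm and exponential in coordinates -/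

section SecondOrder

variable {A : Type u} [CommRing A] {n : ℕ}

theorem CubeZero.secondOrderTuple {I : Ideal A} (hI : CubeZero I) {m : ℕ} {x : Fin m → Fin n → A}
    {e : Fin n → A} (hx : ∀ i a, x i a - e a ∈ I) : SecondOrderTuple x := by
  have h : ∀ i j a, x i a - x j a ∈ I := fun i j a => by
    have := I.sub_mem (hx i a) (hx j a)
    rwa [sub_sub_sub_cancel_right] at this
  exact fun i₁ j₁ i₂ j₂ i₃ j₃ a b c => hI _ (h _ _ _) _ (h _ _ _) _ (h _ _ _)

/-- Adding a bilinear term to the argument does not change the value of `Γ` on the diagonal. -/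
theorem CubeZero.bilin_add_bilin {I : Ideal A} (hI : CubeZero I)
    (Γ γ : Fin n → Fin n → Fin n → A) {x y u : Fin n → A} (hx : ∀ i, x i ∈ I) (hy : ∀ i, y i ∈ I)
    (hu : ∀ i, u i ∈ I) : bilin Γ (u + bilin γ x y) (u + bilin γ x y) = bilin Γ u u := by
  have h1 : bilin Γ (bilin γ x y) u = 0 :=
    bilin_eq_zero fun i j => bilin_mul_eq_zero hI γ hx hy (hu j) i
  have h2 : bilin Γ u (bilin γ x y) = 0 :=
    bilin_eq_zero fun i j => by rw [mul_comm]; exact bilin_mul_eq_zero hI γ hx hy (hu i) j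
  have h3 : bilin Γ (bilin γ x y) (bilin γ x y) = 0 :=
    bilin_eq_zero fun i j => bilin_mul_eq_zero hI γ hx hy (bilin_mem γ hx j) i
  rw [bilin_add_left, bilin_add_right, bilin_add_right, h1, h2, h3, add_zero, add_zero, add_zero]

variable [Algebra ℚ A]

/-- The second-order difference of the products `x y` and `y x`. -/
theorem CubeZero.expCoord_sub {I : Ideal A} (hI : CubeZero I) (Γ γ : Fin n → Fin n → Fin n → A)
    {x y : Fin n → A} (hx : ∀ i, x i ∈ I) (hy : ∀ i, y i ∈ I) :
    expCoord Γ (logCoord Γ (x + y + bilin γ x y) - logCoord Γ (y + x + bilin γ y x)) =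
      bilin γ x y - bilin γ y x := by
  have hxy : ∀ i, (x + y) i ∈ I := fun i => I.add_mem (hx i) (hy i)
  have hyx : ∀ i, (y + x) i ∈ I := fun i => I.add_mem (hy i) (hx i)
  have h1 : logCoord Γ (x + y + bilin γ x y) - logCoord Γ (y + x + bilin γ y x) =
      bilin γ x y - bilin γ y x := by
    rw [logCoord, logCoord, hI.bilin_add_bilin Γ γ hx hy hxy, hI.bilin_add_bilin Γ γ hy hx hyx,
      add_comm y x]
    abel
  have hk : ∀ i, (bilin γ x y - bilin γ y x) i ∈ I := fun i =>
    I.sub_mem (bilin_mem γ hx i) (bilin_mem γ hy i)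
  have h2 : bilin Γ (bilin γ x y - bilin γ y x) (bilin γ x y - bilin γ y x) = 0 :=
    bilin_eq_zero fun i j => by
      rw [Pi.sub_apply, sub_mul, bilin_mul_eq_zero hI γ hx hy (hk j),
        bilin_mul_eq_zero hI γ hy hx (hk j), sub_zero]
  rw [h1, expCoord, h2, smul_zero, add_zero]

end SecondOrder

/-! ### The nil-square monad under restriction and gluing -/

section Monad

variable {C : Type u} [SmallCategory C] {J : GrothendieckTopology C}
  {R : Cᵒᵖ ⥤ Type u} [InternalAlgebra R] {n : ℕ} {M : Cᵒᵖ ⥤ Type u} {U : C}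

theorem inMonad_iff {P Q : M.obj (op U)} : InMonad J R n M P Q ↔
    Locally J U fun W f => ∃ (c : Chart J R n M W) (p x : Fin n → R.obj (op W)),
      NilSq x ∧ c.At (𝟙 W) (M.map f.op P) p ∧ c.At (𝟙 W) (M.map f.op Q) (p + x) := by
  constructor
  · intro h
    refine h.mono fun W f ⟨c, hc, hnil⟩ => ?_
    obtain ⟨p, x, h⟩ := pair_of_nilSquareTuple hnil 0 1
    exact ⟨c, p, x, h⟩
  · intro h
    refine h.mono fun W f ⟨c, p, x, hx, hP, hQ⟩ => ?_
    have h : ∀ i : Fin 2, c.At (𝟙 W) (M.map f.op (![P, Q] i))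
        ((![p, p + x] : Fin 2 → Fin n → R.obj (op W)) i) := fun i => by
      fin_cases i
      · exact hP
      · exact hQ
    refine ⟨c, fun i => (h i).1, ?_⟩
    rw [funext fun i => (h i).2]
    refine nilSquareTuple_pair.2 ?_
    rwa [add_sub_cancel_left]

theorem InMonad.map {P Q : M.obj (op U)} (h : InMonad J R n M P Q) {W : C} (f : W ⟶ U) :
    InMonad J R n M (M.map f.op P) (M.map f.op Q) := by
  rw [inMonad_iff] at h ⊢
  refine (h.pullback f).mono fun V g hg => ?_
  rwa [map_map_op, map_map_op]

theorem InMonad.of_locally {P Q : M.obj (op U)}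
    (h : Locally J U fun _ f => InMonad J R n M (M.map f.op P) (M.map f.op Q)) :
    InMonad J R n M P Q := by
  rw [inMonad_iff]
  refine h.bind fun W f hf => (inMonad_iff.1 hf).mono fun V g hg => ?_
  rwa [map_map_op, map_map_op] at hg

end Monad

/-! ### The bracket of points is the group commutator -/

section PointBracket

open scoped commutatorElement

variable {C : Type u} [SmallCategory C] {J : GrothendieckTopology C}
  {R : Cᵒᵖ ⥤ Type u} [InternalAlgebra R] {n : ℕ} {G : Cᵒᵖ ⥤ Type u} [InternalGroup G] {U W : C}
  {c : Chart J R n G U} {e : Fin n → R.obj (op U)}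

/-- The symmetrised symbol of the multiplication is the connection symbol at `e`. -/
theorem IsProductSymbol.isConnectionSymbol (hR : Presieve.IsSheaf J R) (hI : KockLawvereI R)
    {γ : Fin n → Fin n → Fin n → R.obj (op U)} (hγ : IsProductSymbol c e γ)
    (he : c.At (𝟙 U) 1 e) :
    IsConnectionSymbol J c 1 he.1
      (fun k i j => algebraMap ℚ (R.obj (op U)) (1 / 2) * (γ k i j + γ k j i)) := by
  intro W g Q S L hQm hSm hL hQ hS hLc
  have hp : (fun a => R.map g.op (c.coord (𝟙 U) 1 he.1 a)) = vecRes g e := by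
    rw [he.2]
    rfl
  have he' := Chart.restrict_at_id.2 (he.map_id g)
  obtain ⟨x, hx, hQx⟩ := hQm.exists_at hR hI he'
  obtain ⟨y, hy, hSy⟩ := hSm.exists_at hR hI he'
  have h1 := (hγ.restrict g).mul_at (f := 𝟙 W) hx hy (by rwa [vecRes_id]) (by rwa [vecRes_id])
  have h2 := (hγ.restrict g).mul_at (f := 𝟙 W) hy hx (by rwa [vecRes_id]) (by rwa [vecRes_id])
  simp only [vecRes_id, map_id_op] at h1 h2
  rw [IsSymConnection, leftConnection, rightConnection, group_map_one, inv_one, mul_one,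
    mul_one] at hL
  have h3 := Chart.restrict_at_id.1 (hL.at_of_at hR hI h1 h2)
  intro p
  change p = _ at hp
  rw [hp, (Chart.restrict_at_id.1 hQx).2, (Chart.restrict_at_id.1 hSy).2, h3.2,
    add_sub_cancel_left, add_sub_cancel_left]
  have h4 : algebraMap ℚ (R.obj (op W)) (1 / 2) + algebraMap ℚ (R.obj (op W)) (1 / 2) = 1 := by
    rw [← _root_.map_add]
    norm_num
  ext k
  simp only [Pi.add_apply, Pi.sub_apply, Pi.smul_apply, smul_eq_mul, bilin, scalar_map_mul,
    scalar_map_add, scalar_map_algebraMap]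
  -- At P = e the left and right connections are QS and SQ; exchanging summation indices writes γ(y,
  -- x) as the transposed symbol at (x, y).
  have h5 : ∑ i, ∑ j, R.map g.op (γ k i j) * y i * x j =
      ∑ i, ∑ j, R.map g.op (γ k j i) * x i * y j := by
    rw [Finset.sum_comm]
    exact Finset.sum_congr rfl fun i _ => Finset.sum_congr rfl fun j _ => by ring
  have h6 : ∑ i, ∑ j, algebraMap ℚ (R.obj (op W)) (1 / 2) *
        (R.map g.op (γ k i j) + R.map g.op (γ k j i)) * x i * y j =
      algebraMap ℚ (R.obj (op W)) (1 / 2) * (∑ i, ∑ j, R.map g.op (γ k i j) * x i * y j +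
        ∑ i, ∑ j, R.map g.op (γ k j i) * x i * y j) := by
    simp only [← Finset.sum_add_distrib, Finset.mul_sum]
    exact Finset.sum_congr rfl fun i _ => Finset.sum_congr rfl fun j _ => by ring
  rw [h5, h6]
  linear_combination (vecRes g e k + x k + y k) * h4

theorem group_map_commutator (P Q : G.obj (op U)) (f : W ⟶ U) :
    G.map f.op ⁅P, Q⁆ = ⁅G.map f.op P, G.map f.op Q⁆ := by
  simp only [commutatorElement_def, group_map_mul, group_map_inv]

theorem InMonad.map_one {P : G.obj (op U)} (hP : InMonad J R n G 1 P)
    (f : W ⟶ U) : InMonad J R n G 1 (G.map f.op P) := by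
  rw [← group_map_one f]
  exact hP.map f

theorem IsProductSymbol.mul_at_id {γ : Fin n → Fin n → Fin n → R.obj (op U)}
    (hγ : IsProductSymbol c e γ)
    {x y : Fin n → R.obj (op U)} (hx : NilSq x) (hy : NilSq y) {P Q : G.obj (op U)}
    (hP : c.At (𝟙 U) P (e + x)) (hQ : c.At (𝟙 U) Q (e + y)) :
    c.At (𝟙 U) (P * Q) (e + (x + y + bilin γ x y)) := by
  have h := hγ.mul_at (f := 𝟙 U) hx hy (by rwa [vecRes_id]) (by rwa [vecRes_id])
  simpa only [vecRes_id, map_id_op, add_assoc] using h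

theorem IsProductSymbol.commutator_at_id {γ : Fin n → Fin n → Fin n → R.obj (op U)}
    (hγ : IsProductSymbol c e γ) (he : c.At (𝟙 U) 1 e)
    {x y : Fin n → R.obj (op U)} (hx : NilSq x) (hy : NilSq y) {P Q : G.obj (op U)}
    (hP : c.At (𝟙 U) P (e + x)) (hQ : c.At (𝟙 U) Q (e + y)) :
    c.At (𝟙 U) ⁅P, Q⁆ (e + (bilin γ x y - bilin γ y x)) := by
  have h := hγ.commutator_at he (f := 𝟙 U) hx hy (by rwa [vecRes_id]) (by rwa [vecRes_id])
  simpa only [vecRes_id, map_id_op] using h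

namespace IsLieGroup

theorem exists_at (H : IsLieGroup J R n G) (he : c.At (𝟙 U) 1 e) {P : G.obj (op U)}
    (hP : InMonad J R n G 1 P) : ∃ x, NilSq x ∧ c.At (𝟙 U) P (e + x) :=
  hP.exists_at H.scalar_isSheaf H.kockLawvereI he

theorem inMonad_of_chart (H : IsLieGroup J R n G) {P : G.obj (op U)}
    (h : ∀ ⦃W : C⦄ (f : W ⟶ U) (c : Chart J R n G W) (e : Fin n → R.obj (op W)),
      c.At (𝟙 W) 1 e → InMonad J R n G 1 (G.map f.op P)) : InMonad J R n G 1 P := by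
  refine InMonad.of_locally ((H.exists_chart U).mono fun W f ⟨c, e, he⟩ => ?_)
  rw [group_map_one]
  exact h f c e he

theorem inMonad_commutator (H : IsLieGroup J R n G) {P Q : G.obj (op U)}
    (hP : InMonad J R n G 1 P) (hQ : InMonad J R n G 1 Q) : InMonad J R n G 1 ⁅P, Q⁆ := by
  refine H.inMonad_of_chart fun W f c e he => ?_
  obtain ⟨x, hx, hPx⟩ := H.exists_at he (hP.map_one f)
  obtain ⟨y, hy, hQy⟩ := H.exists_at he (hQ.map_one f)
  obtain ⟨γ, hγ⟩ := exists_isProductSymbol H.kockLawvereII he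
  rw [group_map_commutator]
  exact InMonad.of_at he (bracketCoord_nilSq γ hx hy) (hγ.commutator_at_id he hx hy hPx hQy)

/-- The Lie bracket of points is the group commutator. -/
theorem isPointBracket_iff (H : IsLieGroup J R n G) {P Q S : G.obj (op U)}
    (hP : InMonad J R n G 1 P) (hQ : InMonad J R n G 1 Q) :
    IsPointBracket J R n P Q S ↔ S = ⁅P, Q⁆ := by
  constructor
  · intro h
    -- The symbol Γ may be arbitrary here: its contributions cancel, so this direction does not use
    -- that it comes from the connection.
    refine eq_of_locally H.isFormalManifold.1 (h.mono fun W f ⟨c, he, hPQ, hS, Γ, _, _, hval⟩ => ?_)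
    set e := c.coord (𝟙 W) 1 he with he_def
    have hc : c.At (𝟙 W) 1 e := Chart.at_coord he
    obtain ⟨x, hx, hPx⟩ := H.exists_at hc (hP.map_one f)
    obtain ⟨y, hy, hQy⟩ := H.exists_at hc (hQ.map_one f)
    obtain ⟨γ, hγ⟩ := exists_isProductSymbol H.kockLawvereII hc
    obtain ⟨I, hI, hxI, hyI⟩ := hx.exists_cubeZero hy
    have h0 : c.coord (𝟙 W) _ (hPQ 0) = e + (x + y + bilin γ x y) := by
      refine (Chart.at_coord (hPQ 0)).unique ?_
      change c.At (𝟙 W) (G.map f.op (P * Q)) _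
      rw [group_map_mul]
      exact hγ.mul_at_id hx hy hPx hQy
    have h1 : c.coord (𝟙 W) _ (hPQ 1) = e + (y + x + bilin γ y x) := by
      refine (Chart.at_coord (hPQ 1)).unique ?_
      change c.At (𝟙 W) (G.map f.op (Q * P)) _
      rw [group_map_mul]
      exact hγ.mul_at_id hy hx hQy hPx
    have hS' : c.At (𝟙 W) (G.map f.op S) (e + (bilin γ x y - bilin γ y x)) := by
      refine ⟨hS, ?_⟩
      rw [hval, Fin.sum_univ_two, h0, h1, add_sub_cancel_left, add_sub_cancel_left]
      simp only [Matrix.cons_val_zero, Matrix.cons_val_one, scalar_map_one, scalar_map_neg,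
        one_smul, neg_smul, ← sub_eq_add_neg]
      rw [hI.expCoord_sub Γ γ hxI hyI]
    rw [group_map_commutator]
    exact hS'.inj (hγ.commutator_at_id hc hx hy hPx hQy)
  · rintro rfl
    refine (H.exists_chart U).mono fun W f ⟨c, e, he⟩ => ?_
    obtain ⟨x, hx, hPx⟩ := H.exists_at he (hP.map_one f)
    obtain ⟨y, hy, hQy⟩ := H.exists_at he (hQ.map_one f)
    obtain ⟨γ, hγ⟩ := exists_isProductSymbol H.kockLawvereII he
    obtain ⟨I, hI, hxI, hyI⟩ := hx.exists_cubeZero hy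
    have h0 : c.At (𝟙 W) (G.map f.op (P * Q)) (e + (x + y + bilin γ x y)) := by
      rw [group_map_mul]
      exact hγ.mul_at_id hx hy hPx hQy
    have h1 : c.At (𝟙 W) (G.map f.op (Q * P)) (e + (y + x + bilin γ y x)) := by
      rw [group_map_mul]
      exact hγ.mul_at_id hy hx hQy hPx
    have h2 : c.At (𝟙 W) (G.map f.op ⁅P, Q⁆) (e + (bilin γ x y - bilin γ y x)) := by
      rw [group_map_commutator]
      exact hγ.commutator_at_id he hx hy hPx hQy
    have h01 : ∀ i : Fin 2, c.At (𝟙 W) (G.map f.op (![P * Q, Q * P] i))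
        ((![e + (x + y + bilin γ x y), e + (y + x + bilin γ y x)] :
          Fin 2 → Fin n → R.obj (op W)) i) := fun i => by
      fin_cases i
      · exact h0
      · exact h1
    -- For existence an actual connection symbol has to be exhibited: the symmetrisation of γ.
    refine ⟨c, he.1, fun i => (h01 i).1, h2.1, _,
      hγ.isConnectionSymbol H.scalar_isSheaf H.kockLawvereI he, ?_, ?_⟩
    · rw [funext fun i => (h01 i).2, he.2]
      refine hI.secondOrderTuple (e := e) fun i a => ?_
      refine Fin.cases ?_ (fun i => ?_) i
      · simp
      · fin_cases i
        · simpa using I.add_mem (I.add_mem (hxI a) (hyI a)) (bilin_mem γ hxI a)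
        · simpa using I.add_mem (I.add_mem (hyI a) (hxI a)) (bilin_mem γ hyI a)
    · rw [h2.2, he.2, Fin.sum_univ_two, (h01 0).2, (h01 1).2]
      simp only [Matrix.cons_val_zero, Matrix.cons_val_one, scalar_map_one, scalar_map_neg,
        one_smul, neg_smul, ← sub_eq_add_neg, add_sub_cancel_left]
      rw [hI.expCoord_sub _ γ hxI hyI]

end IsLieGroup

end PointBracket

/-! ### The first-order logarithm -/

section Logarithm

open tangentSpace
open scoped commutatorElement

variable {C : Type u} [SmallCategory C] {J : GrothendieckTopology C}
  {R : Cᵒᵖ ⥤ Type u} [InternalAlgebra R] {n : ℕ} {G : Cᵒᵖ ⥤ Type u} [InternalGroup G] {U W : C}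
  {c : Chart J R n G U} {e : Fin n → R.obj (op U)}

theorem isLog_iff {Q : G.obj (op U)} {t : (tangentSpace R G).obj (op U)} :
    IsLog J n Q t ↔ Locally J U fun W f =>
      ∃ (c : Chart J R n G W) (e x : Fin n → R.obj (op W)), c.At (𝟙 W) 1 e ∧
        c.At (𝟙 W) (G.map f.op Q) (e + x) ∧
        IsPrincipalPart c e ((tangentSpace R G).map f.op t) x := by
  constructor
  · intro h
    refine h.mono fun W f ⟨c, he, hQ, ht⟩ => ⟨c, _, c.coord _ _ hQ - c.coord _ _ he,
      Chart.at_coord he, ?_, fun V g d => ?_⟩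
    · rw [add_sub_cancel]
      exact Chart.at_coord hQ
    · obtain ⟨hd, h⟩ := ht g d
      exact ⟨hd, funext h⟩
  · intro h
    refine h.mono fun W f ⟨c, e, x, he, hQ, ht⟩ => ⟨c, he.1, hQ.1, fun V g d => ⟨(ht g d).1,
      fun a => ?_⟩⟩
    rw [he.2, hQ.2, Pi.add_apply, add_sub_cancel_left]
    exact congrFun (ht g d).2 a

theorem IsLog.map {Q : G.obj (op U)} {t : (tangentSpace R G).obj (op U)} (h : IsLog J n Q t)
    (f : W ⟶ U) : IsLog J n (G.map f.op Q) ((tangentSpace R G).map f.op t) := by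
  rw [isLog_iff] at h ⊢
  refine (h.pullback f).mono fun V g hg => ?_
  rwa [map_map_op, map_map_op]

theorem IsLog.of_locally {Q : G.obj (op U)} {t : (tangentSpace R G).obj (op U)}
    (h : Locally J U fun _ f => IsLog J n (G.map f.op Q) ((tangentSpace R G).map f.op t)) :
    IsLog J n Q t := by
  rw [isLog_iff]
  refine h.bind fun W f hf => (isLog_iff.1 hf).mono fun V g hg => ?_
  rwa [map_map_op, map_map_op] at hg

theorem IsLog.of_at {Q : G.obj (op U)} {t : (tangentSpace R G).obj (op U)}
    {a : Fin n → R.obj (op U)} (he : c.At (𝟙 U) 1 e) (hQ : c.At (𝟙 U) Q (e + a))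
    (ht : IsPrincipalPart c e t a) : IsLog J n Q t := by
  refine isLog_iff.2 (Locally.of_forall fun W f => ⟨c.restrict f, vecRes f e, vecRes f a, ?_, ?_,
    ht.restrict f⟩)
  · rw [Chart.restrict_at_id, ← group_map_one f]
    exact he.map_id f
  · rw [Chart.restrict_at_id, ← vecRes_add]
    exact hQ.map_id f

/-- In any chart around `e`, the coordinates of a point of `𝔐(e)` are given by the principal part
of its logarithm. -/
theorem IsLog.at_of_isPrincipalPart (hR : Presieve.IsSheaf J R) (hI : KockLawvereI R)
    {Q : G.obj (op U)} {t : (tangentSpace R G).obj (op U)} {a : Fin n → R.obj (op U)}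
    (h : IsLog J n Q t) (hQ : InMonad J R n G 1 Q) (he : c.At (𝟙 U) 1 e)
    (ht : IsPrincipalPart c e t a) : NilSq a ∧ c.At (𝟙 U) Q (e + a) := by
  obtain ⟨x, hx, hQx⟩ := hQ.exists_at hR hI he
  suffices hax : a = x by
    rw [hax]
    exact ⟨hx, hQx⟩
  refine eq_of_locally_vecRes hR ((isLog_iff.1 h).mono fun W f ⟨c', e', x', he', hQ', ht'⟩ => ?_)
  have he'' : (c.restrict f).At (𝟙 W) 1 (vecRes f e) := by
    rw [Chart.restrict_at_id, ← group_map_one f]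
    exact he.map_id f
  obtain ⟨A, hA⟩ := Chart.exists_transition hI he' he''
  obtain ⟨y, hy, hQy⟩ := (hQ.map_one f).exists_at hR hI he'
  have hxy : x' = y := add_left_cancel (hQ'.unique hQy)
  rw [← hxy] at hy
  have h1 := hA (𝟙 W) x' _ hy (by rwa [vecRes_id])
  rw [Chart.restrict_at_id, vecRes_id] at h1
  have h2 := h1.unique (hQx.map_id f)
  rw [vecRes_add] at h2
  have h3 : (A.map (scalarRes R (𝟙 W))) = A := by
    ext i j
    exact map_id_op R _
  rw [h3] at h2
  rw [← add_left_cancel h2]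
  refine (ht.restrict f).unique hI fun V g d => ?_
  -- The same matrix A transports both x' and d x', so the principal part of t and the coordinate
  -- difference of Q change by the same rule.
  have h4 := hA g (d.1 • vecRes g x') _ ((hy.vecRes g).smul d.1) (ht' g d)
  rwa [Matrix.mulVec_smul, show (A.map (scalarRes R g)).mulVec (vecRes g x') =
    vecRes g (A.mulVec x') from funext fun i => ((scalarRes R g).map_mulVec A x' i).symm] at h4

namespace IsLieGroup

theorem log_unique (H : IsLieGroup J R n G) {Q : G.obj (op U)}
    {s t : (tangentSpace R G).obj (op U)} (hQ : InMonad J R n G 1 Q) (hs : IsLog J n Q s)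
    (ht : IsLog J n Q t) : s = t := by
  refine H.tangent_ext fun W f c e he => ?_
  obtain ⟨a, ha⟩ := exists_isPrincipalPart H.kockLawvereI he ((tangentSpace R G).map f.op s)
  obtain ⟨b, hb⟩ := exists_isPrincipalPart H.kockLawvereI he ((tangentSpace R G).map f.op t)
  have h1 := (hs.map f).at_of_isPrincipalPart H.scalar_isSheaf H.kockLawvereI (hQ.map_one f) he ha
  have h2 := (ht.map f).at_of_isPrincipalPart H.scalar_isSheaf H.kockLawvereI (hQ.map_one f) he hb
  rw [← add_left_cancel (h1.2.unique h2.2)] at hb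
  exact ha.inj hb

theorem exp_unique (H : IsLieGroup J R n G) {P Q : G.obj (op U)}
    {t : (tangentSpace R G).obj (op U)} (hP : InMonad J R n G 1 P) (hQ : InMonad J R n G 1 Q)
    (hPt : IsLog J n P t) (hQt : IsLog J n Q t) : P = Q := by
  refine eq_of_locally H.isFormalManifold.1 ((H.exists_chart U).mono fun W f ⟨c, e, he⟩ => ?_)
  obtain ⟨a, ha⟩ := exists_isPrincipalPart H.kockLawvereI he ((tangentSpace R G).map f.op t)
  exact ((hPt.map f).at_of_isPrincipalPart H.scalar_isSheaf H.kockLawvereI (hP.map_one f) he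
    ha).2.inj ((hQt.map f).at_of_isPrincipalPart H.scalar_isSheaf H.kockLawvereI (hQ.map_one f) he
    ha).2

/-- The logarithm of the group commutator is the bracket of the logarithms. -/
theorem isLog_commutator (H : IsLieGroup J R n G) {P Q : G.obj (op U)}
    {s t : (tangentSpace R G).obj (op U)} (hP : InMonad J R n G 1 P) (hQ : InMonad J R n G 1 Q)
    (hPs : IsLog J n P s) (hQt : IsLog J n Q t) : IsLog J n ⁅P, Q⁆ (H.bracket s t) := by
  refine IsLog.of_locally ((H.exists_chart U).mono fun W f ⟨c, e, he⟩ => ?_)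
  obtain ⟨a, ha⟩ := exists_isPrincipalPart H.kockLawvereI he ((tangentSpace R G).map f.op s)
  obtain ⟨b, hb⟩ := exists_isPrincipalPart H.kockLawvereI he ((tangentSpace R G).map f.op t)
  obtain ⟨hna, hPa⟩ := (hPs.map f).at_of_isPrincipalPart H.scalar_isSheaf H.kockLawvereI
    (hP.map_one f) he ha
  obtain ⟨hnb, hQb⟩ := (hQt.map f).at_of_isPrincipalPart H.scalar_isSheaf H.kockLawvereI
    (hQ.map_one f) he hb
  obtain ⟨γ, hγ⟩ := exists_isProductSymbol H.kockLawvereII he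
  obtain ⟨w, hw⟩ := exists_of_principalPart he (bilin γ a b - bilin γ b a)
  rw [H.map_bracket, H.bracket_eq (ha.isTangentBracket he hγ hb hw), group_map_commutator]
  exact IsLog.of_at he (hγ.commutator_at_id he hna hnb hPa hQb) hw

end IsLieGroup

end Logarithm

/-! ### Bilinear maps and the space D(T) -/

section BilinearMaps

variable {C : Type u} [SmallCategory C] {R : Cᵒᵖ ⥤ Type u} [InternalAlgebra R] {U W : C}

/-- Restriction of a bilinear map to a later stage. -/
def StageBilin.restrict {T Y : Cᵒᵖ ⥤ Type u} [∀ U, AddCommGroup (T.obj U)]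
    [∀ U, Module (R.obj U) (T.obj U)] [∀ U, AddCommGroup (Y.obj U)]
    [∀ U, Module (R.obj U) (Y.obj U)] (φ : StageBilin R T Y U) (f : W ⟶ U) :
    StageBilin R T Y W where
  app _ g := φ.app (g ≫ f)
  naturality _ _ g h x y := by rw [φ.naturality, Category.assoc]

variable {T : Cᵒᵖ ⥤ Type u} [InternalLieRing T] [InternalLieAlgebra R T]

theorem InD.map {t : T.obj (op U)} (ht : InD (R := R) t) (f : W ⟶ U) :
    InD (R := R) (T.map f.op t) := fun V g φ => by
  rw [map_map_op]
  exact ht (g ≫ f) φ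

theorem InD.of_locally {J : GrothendieckTopology C} (hR : Presieve.IsSheaf J R) {t : T.obj (op U)}
    (h : Locally J U fun _ f => InD (R := R) (T.map f.op t)) : InD (R := R) t := by
  refine fun W f φ => eq_of_locally hR ((h.pullback f).mono fun V g hg => ?_)
  have := hg (𝟙 V) (φ.restrict g)
  rw [map_id_op] at this
  rw [φ.naturality, scalar_map_zero, map_map_op]
  simpa only [StageBilin.restrict, Category.id_comp, Category.comp_id] using this

/-- A bilinear form acquires the factor d². This supplies enough elements of D(T) to determine a
bilinear map. -/
theorem inD_smul_of_mul_self {t : T.obj (op U)} {d : R.obj (op U)} (hd : d * d = 0) :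
    InD (R := R) (d • t) := fun W f φ => by
  have : T.map f.op (d • t) = R.map f.op d • T.map f.op t :=
    InternalLieAlgebra.map_smul f.op d t
  rw [this, LinearMap.map_smul, LinearMap.map_smul, LinearMap.smul_apply, smul_smul,
    ← scalar_map_mul, hd, scalar_map_zero, zero_smul]

end BilinearMaps

/-! ### D(T_eG), the exp-log lift and left-invariant fields -/

section InD

variable {C : Type u} [SmallCategory C] {J : GrothendieckTopology C}
  {R : Cᵒᵖ ⥤ Type u} [InternalAlgebra R] {n : ℕ} {G : Cᵒᵖ ⥤ Type u} [InternalGroup G] {U W : C}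
  {c : Chart J R n G U} {e : Fin n → R.obj (op U)}

namespace IsLieGroup

/-- The principal part as a linear map. -/
theorem exists_principalPart_linearMap (H : IsLieGroup J R n G) (he : c.At (𝟙 U) 1 e) :
    letI := H.internalLieRing
    letI := H.internalLieAlgebra
    ∃ p : (tangentSpace R G).obj (op U) →ₗ[R.obj (op U)] (Fin n → R.obj (op U)),
      ∀ t, IsPrincipalPart c e t (p t) := by
  let := H.internalLieRing
  let := H.internalLieAlgebra
  choose p hp using fun t : (tangentSpace R G).obj (op U) =>
    exists_isPrincipalPart H.kockLawvereI he t
  refine ⟨⟨⟨p, fun s t => ?_⟩, fun r t => ?_⟩, hp⟩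
  · exact (hp (s + t)).unique H.kockLawvereI ((hp s).add H.kockLawvereII he (hp t))
  · exact (hp (r • t)).unique H.kockLawvereI ((hp t).smul r)

/-- Principal parts identify T_eG with Rⁿ around a chart. Products of two coordinates are themselves
bilinear forms, and conversely every bilinear form is a combination of them. -/
theorem inD_iff (H : IsLieGroup J R n G) (he : c.At (𝟙 U) 1 e)
    {t : (tangentSpace R G).obj (op U)} {a : Fin n → R.obj (op U)}
    (ht : IsPrincipalPart c e t a) :
    letI := H.internalLieRing
    letI := H.internalLieAlgebra
    InD (R := R) t ↔ NilSq a := by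
  let := H.internalLieRing
  let := H.internalLieAlgebra
  have he' : ∀ ⦃W : C⦄ (f : W ⟶ U), (c.restrict f).At (𝟙 W) 1 (vecRes f e) := fun W f => by
    rw [Chart.restrict_at_id, ← group_map_one f]
    exact he.map_id f
  choose p hp using fun (W : C) (f : W ⟶ U) => H.exists_principalPart_linearMap (he' f)
  constructor
  · intro h i j
    -- The test form multiplies the i-th and the j-th coordinates of the principal parts; uniqueness
    -- of principal parts makes it natural in the stage.
    let φ : StageBilin R (tangentSpace R G) R U :=
      { app := fun W f => LinearMap.mk₂ (R.obj (op W)) (fun s t => p W f s i * p W f t j)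
          (fun s s' t => by rw [map_add, Pi.add_apply, add_mul])
          (fun r s t => by rw [map_smul, Pi.smul_apply, smul_mul_assoc])
          (fun s t t' => by rw [map_add, Pi.add_apply, mul_add])
          (fun r s t => by rw [map_smul, Pi.smul_apply, mul_smul_comm])
        naturality := fun W V f g s t => by
          have h : ∀ s, p V (g ≫ f) ((tangentSpace R G).map g.op s) = vecRes g (p W f s) := by
            intro s
            refine (hp V (g ≫ f) _).unique H.kockLawvereI fun V' k d => ?_
            have := (hp W f s).restrict g k d
            rw [Chart.restrict_at, Chart.restrict_at, Category.assoc] at this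
            rw [Chart.restrict_at, ← vecRes_vecRes f g]
            exact this
          rw [LinearMap.mk₂_apply, LinearMap.mk₂_apply, h, h, scalar_map_mul]
          rfl }
    have h1 := h (𝟙 U) φ
    rw [map_id_op] at h1
    have h2 : p U (𝟙 U) t = a := by
      refine (hp U (𝟙 U) t).unique H.kockLawvereI fun V k d => ?_
      rw [Chart.restrict_at, vecRes_id, Category.comp_id]
      exact ht k d
    change p U (𝟙 U) t i * p U (𝟙 U) t j = 0 at h1
    rwa [h2] at h1
  · intro ha W f φ
    -- The tangent vectors with principal parts the unit vectors expand t as ∑ aᵢEᵢ, so φ[t, t] is a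
    -- combination of the products aᵢaⱼ.
    choose E hE using fun i => exists_of_principalPart (R := R) (he' f)
      (Pi.single i (1 : R.obj (op W)))
    have h1 : (tangentSpace R G).map f.op t = ∑ i, vecRes f a i • E i := by
      refine IsPrincipalPart.inj (c := c.restrict f) (e := vecRes f e) (ht.restrict f) ?_
      have h2 := hp W f (∑ i, vecRes f a i • E i)
      have h3 : p W f (∑ i, vecRes f a i • E i) = vecRes f a := by
        rw [map_sum]
        simp only [map_smul]
        have h4 : ∀ i, p W f (E i) = Pi.single i (1 : R.obj (op W)) := fun i =>
          (hp W f (E i)).unique H.kockLawvereI (hE i)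
        simp only [h4]
        exact (pi_eq_sum_univ' (vecRes f a)).symm
      rwa [h3] at h2
    rw [h1, map_sum]
    refine Finset.sum_eq_zero fun i _ => ?_
    rw [map_sum, LinearMap.sum_apply]
    refine Finset.sum_eq_zero fun j _ => ?_
    rw [LinearMap.map_smul, LinearMap.map_smul, LinearMap.smul_apply, smul_smul, ha.vecRes f,
      zero_smul]

/-- In a chart the coordinate difference of Q from e serves as principal part; uniqueness of
logarithms allows gluing. -/
theorem exists_log (H : IsLieGroup J R n G) {Q : G.obj (op U)} (hQ : InMonad J R n G 1 Q) :
    letI := H.internalLieRing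
    letI := H.internalLieAlgebra
    ∃ t : (tangentSpace R G).obj (op U), InD (R := R) t ∧ IsLog J n Q t := by
  let := H.internalLieRing
  let := H.internalLieAlgebra
  obtain ⟨t, ht⟩ := exists_of_locally_existsUnique (J := J) H.tangent_isSheaf
    (fun W f t => InD (R := R) t ∧ IsLog J n (G.map f.op Q) t)
    (fun W V f g t h => ⟨h.1.map g, by
      have := h.2.map g
      rwa [map_map_op] at this⟩)
    (fun W f s t hs ht => H.log_unique (hQ.map_one f) hs.2 ht.2)
    ((H.exists_chart U).mono fun W f ⟨c, e, he⟩ => by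
      obtain ⟨x, hx, hQx⟩ := H.exists_at he (hQ.map_one f)
      obtain ⟨t, ht⟩ := exists_of_principalPart he x
      exact ⟨t, (H.inD_iff he ht).2 hx, IsLog.of_at he hQx ht⟩)
  exact ⟨t, InD.of_locally H.scalar_isSheaf (ht.mono fun _ _ h => h.1),
    IsLog.of_locally (ht.mono fun _ _ h => h.2)⟩

theorem exists_exp (H : IsLieGroup J R n G) {t : (tangentSpace R G).obj (op U)}
    (ht : letI := H.internalLieRing
      letI := H.internalLieAlgebra
      InD (R := R) t) :
    ∃ Q : G.obj (op U), InMonad J R n G 1 Q ∧ IsLog J n Q t := by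
  let := H.internalLieRing
  let := H.internalLieAlgebra
  obtain ⟨Q, hQ⟩ := exists_of_locally_existsUnique (J := J) H.isFormalManifold.1
    (fun W f Q => InMonad J R n G 1 Q ∧ IsLog J n Q ((tangentSpace R G).map f.op t))
    (fun W V f g Q h => ⟨h.1.map_one g, by
      have := h.2.map g
      rwa [map_map_op] at this⟩)
    (fun W f P Q hP hQ => H.exp_unique hP.1 hQ.1 hP.2 hQ.2)
    ((H.exists_chart U).mono fun W f ⟨c, e, he⟩ => by
      obtain ⟨a, ha⟩ := exists_isPrincipalPart H.kockLawvereI he ((tangentSpace R G).map f.op t)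
      have hna := (H.inD_iff he ha).1 (InD.map ht f)
      obtain ⟨Q, hQ⟩ := Chart.exists_at_add he (𝟙 W) hna
      rw [vecRes_id] at hQ
      exact ⟨Q, InMonad.of_at he hna hQ, IsLog.of_at he hQ ha⟩)
  refine ⟨Q, InMonad.of_locally (hQ.mono fun W f h => ?_), IsLog.of_locally (hQ.mono fun _ _ h =>
    h.2)⟩
  rw [group_map_one]
  exact h.1

theorem logBijective (H : IsLieGroup J R n G) :
    letI := H.internalLieRing
    letI := H.internalLieAlgebra
    LogBijective R J n G := by
  let := H.internalLieRing
  let := H.internalLieAlgebra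
  refine fun U => ⟨fun Q hQ => ?_, fun t ht => ?_⟩
  · obtain ⟨t, ht⟩ := H.exists_log hQ
    exact ⟨t, ht, fun s hs => H.log_unique hQ hs.2 ht.2⟩
  · obtain ⟨Q, hQ⟩ := H.exists_exp ht
    exact ⟨Q, hQ, fun P hP => H.exp_unique hP.1 hQ.1 hP.2 hQ.2⟩

/-- The module operations were defined by products and reparametrisation, but on principal parts
they are addition and scaling. All points involved have the form e + dv with a common d, so they are
nil-square neighbours. -/
theorem pointwiseLinear (H : IsLieGroup J R n G) :
    letI := H.internalLieRing
    letI := H.internalLieAlgebra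
    PointwiseLinear R J n G := by
  let := H.internalLieRing
  let := H.internalLieAlgebra
  have hat : ∀ ⦃U W V : C⦄ (t : (tangentSpace R G).obj (op U)) (f : W ⟶ U) (g : V ⟶ W)
      (d : (disc R).obj (op W)) {c : Chart J R n G V} {e : Fin n → R.obj (op V)}
      {a : Fin n → R.obj (op V)},
      IsPrincipalPart c e ((tangentSpace R G).map (g ≫ f).op t) a →
      c.At (𝟙 V) (G.map g.op (t.1.app f d)) (e + R.map g.op d.1 • a) := by
    intro U W V t f g d c e a ha
    have h := ha (𝟙 V) ((disc R).map g.op d)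
    rw [vecRes_id, vecRes_id, tangentSpace.map_app, Category.id_comp, ← t.1.naturality] at h
    exact h
  constructor
  · intro U s t W f d
    refine IsAffineComb.of_locally_at (by simp [Fin.sum_univ_three])
      ((H.exists_chart W).mono fun V g ⟨c, e, he⟩ => ?_)
    obtain ⟨a, ha⟩ := exists_isPrincipalPart H.kockLawvereI he ((tangentSpace R G).map (g ≫ f).op s)
    obtain ⟨b, hb⟩ := exists_isPrincipalPart H.kockLawvereI he ((tangentSpace R G).map (g ≫ f).op t)
    refine ⟨c, fun i => e + R.map g.op d.1 • (![0, a, b] : Fin 3 → Fin n → R.obj (op V)) i,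
      fun i => ?_, nilSquareTuple_add_smul e ((disc R).map g.op d).2 _, ?_⟩
    · fin_cases i
      · change c.At (𝟙 V) (G.map g.op 1) (e + R.map g.op d.1 • (0 : Fin n → R.obj (op V)))
        rwa [group_map_one, smul_zero, add_zero]
      · exact hat s f g d ha
      · exact hat t f g d hb
    · have h := hat (s + t) f g d (ha.add H.kockLawvereII he hb)
      convert h using 1
      rw [Fin.sum_univ_three]
      change R.map g.op (-1) • (e + R.map g.op d.1 • (0 : Fin n → R.obj (op V))) +
        R.map g.op 1 • (e + R.map g.op d.1 • a) + R.map g.op 1 • (e + R.map g.op d.1 • b) = _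
      rw [scalar_map_neg, scalar_map_one, smul_zero, neg_one_smul, one_smul, one_smul, smul_add]
      abel
  · intro U r t W f d
    refine IsAffineComb.of_locally_at (by simp [Fin.sum_univ_two])
      ((H.exists_chart W).mono fun V g ⟨c, e, he⟩ => ?_)
    obtain ⟨a, ha⟩ := exists_isPrincipalPart H.kockLawvereI he ((tangentSpace R G).map (g ≫ f).op t)
    refine ⟨c, fun i => e + R.map g.op d.1 • (![0, a] : Fin 2 → Fin n → R.obj (op V)) i,
      fun i => ?_, nilSquareTuple_add_smul e ((disc R).map g.op d).2 _, ?_⟩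
    · fin_cases i
      · change c.At (𝟙 V) (G.map g.op 1) (e + R.map g.op d.1 • (0 : Fin n → R.obj (op V)))
        rwa [group_map_one, smul_zero, add_zero]
      · exact hat t f g d ha
    · have h1 := ha.smul (R.map (g ≫ f).op r)
      rw [← tangentSpace.map_smul] at h1
      have h := hat (r • t) f g d h1
      convert h using 1
      rw [Fin.sum_univ_two]
      change R.map g.op (1 - R.map f.op r) • (e + R.map g.op d.1 • (0 : Fin n → R.obj (op V))) +
        R.map g.op (R.map f.op r) • (e + R.map g.op d.1 • a) = _
      rw [scalar_map_sub, scalar_map_one, map_map_op, smul_zero, add_zero, sub_smul, one_smul,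
        smul_add, smul_comm (R.map g.op d.1)]
      abel

theorem liftsPointBracket (H : IsLieGroup J R n G) (U : C) :
    letI := H.internalLieRing
    letI := H.internalLieAlgebra
    LiftsPointBracket R J n (G := G) (U := U) (fun _ _ s t => ⁅s, t⁆) := by
  let := H.internalLieRing
  let := H.internalLieAlgebra
  intro W f s t hs ht
  obtain ⟨P, hP, hPs⟩ := H.exists_exp hs
  obtain ⟨Q, hQ, hQt⟩ := H.exists_exp ht
  have hS := H.inMonad_commutator hP hQ
  have hlog := H.isLog_commutator hP hQ hPs hQt
  refine ⟨?_, P, Q, _, hP, hQ, hS, hPs, hQt, (H.isPointBracket_iff hP hQ).2 rfl, hlog⟩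
  obtain ⟨v, hv, hvS⟩ := H.exists_log hS
  rw [H.log_unique hS hvS hlog] at hv
  exact hv

/-- On D(T_eG) the lift is forced, since logarithms are unique. Arbitrary s and t are reached
through d₁s and d₂t, which lie in D(T_eG); bilinearity extracts d₁d₂, which is then cancelled. -/
theorem eq_bracket_of_liftsPointBracket (H : IsLieGroup J R n G) :
    letI := H.internalLieRing
    letI := H.internalLieAlgebra
    ∀ B : StageBilin R (tangentSpace R G) (tangentSpace R G) U,
      LiftsPointBracket R J n (fun _ f s t => B.app f s t) →
      ∀ ⦃W : C⦄ (f : W ⟶ U) (s t : (tangentSpace R G).obj (op W)), B.app f s t = ⁅s, t⁆ := by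
  let := H.internalLieRing
  let := H.internalLieAlgebra
  intro B hB
  have hD : ∀ ⦃W : C⦄ (f : W ⟶ U) (s t : (tangentSpace R G).obj (op W)),
      InD (R := R) s → InD (R := R) t → B.app f s t = ⁅s, t⁆ := by
    intro W f s t hs ht
    obtain ⟨-, P, Q, S, hP, hQ, hS, hPs, hQt, hPQ, hlog⟩ := hB f s t hs ht
    rw [H.isPointBracket_iff hP hQ] at hPQ
    rw [hPQ] at hS hlog
    exact H.log_unique hS hlog (H.isLog_commutator hP hQ hPs hQt)
  intro W f s t
  refine H.tangent_ext_mul_mul fun V g d₁ d₂ d₃ => ?_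
  have h1 := hD (g ≫ f) (d₁.1 • (tangentSpace R G).map g.op s) (d₂.1 • (tangentSpace R G).map g.op t)
    (inD_smul_of_mul_self d₁.2) (inD_smul_of_mul_self d₂.2)
  rw [LinearMap.map_smul, LinearMap.map_smul, LinearMap.smul_apply, ← B.naturality, smul_lie,
    lie_smul, ← InternalLieRing.map_lie, smul_smul, smul_smul, mul_comm d₂.1] at h1
  have h2 := congrArg (fun v : (tangentSpace R G).obj (op V) => v.1.app (𝟙 V) d₃) h1
  change ((B.app f s t).1.app (𝟙 V ≫ g) (disc.smul (R.map (𝟙 V).op (d₁.1 * d₂.1)) d₃)) =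
    ((⁅s, t⁆ : (tangentSpace R G).obj (op W)).1.app (𝟙 V ≫ g)
      (disc.smul (R.map (𝟙 V).op (d₁.1 * d₂.1)) d₃)) at h2
  rw [map_id_op, Category.id_comp] at h2
  exact h2

theorem isLieBracket_iff (H : IsLieGroup J R n G) (s t : (tangentSpace R G).obj (op U))
    (Z : VectorField R G U) :
    IsLieBracket (leftInvariant s) (leftInvariant t) Z ↔ Z = leftInvariant (H.bracket s t) := by
  have hneg : ∀ (t : (tangentSpace R G).obj (op U)) ⦃W : C⦄ (f : W ⟶ U) (d : (disc R).obj (op W)),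
      t.1.app f (disc.neg d) = (t.1.app f d)⁻¹ := by
    intro t W f d
    let := H.internalLieRing
    let := H.internalLieAlgebra
    -- In the module T_eG, (-1)t is d ↦ t(-d) and -t is the pointwise inverse; their equality gives
    -- t(-d) = t(d)⁻¹.
    have h := congrArg (fun v : (tangentSpace R G).obj (op U) => v.1.app f d)
      (neg_one_smul (R.obj (op U)) t)
    change t.1.app f (disc.smul (R.map f.op (-1)) d) = (t.1.app f d)⁻¹ at h
    rw [← h]
    congr 1
    refine Subtype.ext ?_
    change -d.1 = R.map f.op (-1) * d.1
    rw [scalar_map_neg, scalar_map_one, neg_one_mul]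
  have hprod : ∀ ⦃W : C⦄ (f : W ⟶ U) (p : G.obj (op W)) (d₁ d₂ : (disc R).obj (op W)),
      (leftInvariant t).app f ((leftInvariant s).app f ((leftInvariant t).app f
        ((leftInvariant s).app f p d₁) d₂) (disc.neg d₁)) (disc.neg d₂) =
      p * (H.bracket s t).1.app f (disc.mul d₁ d₂) := by
    intro W f p d₁ d₂
    change p * s.1.app f d₁ * t.1.app f d₂ * s.1.app f (disc.neg d₁) * t.1.app f (disc.neg d₂) = _
    rw [H.bracket_spec s t, hneg, hneg, commutatorElement_def]
    simp only [mul_assoc]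
  constructor
  · intro hZ
    ext W f p d
    -- Z is not known to be left-invariant, so for each p its value there is translated back to e;
    -- the result is determined by its values at products d₁d₂.
    let w : (tangentSpace R G).obj (op W) := tangentSpace.mk
      (fun V g d => (G.map g.op p)⁻¹ * Z.app (g ≫ f) (G.map g.op p) d)
      (fun V V' g h d => by
        rw [group_map_mul, group_map_inv, Z.naturality, map_map_op, Category.assoc])
      (fun V g => by rw [Z.app_zero, inv_mul_cancel])
    have hw : w = (tangentSpace R G).map f.op (H.bracket s t) := by
      refine H.tangent_ext_mul fun V g d₁ d₂ => ?_
      change (G.map g.op p)⁻¹ * Z.app (g ≫ f) (G.map g.op p) (disc.mul d₁ d₂) =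
        (H.bracket s t).1.app (g ≫ f) (disc.mul d₁ d₂)
      rw [hZ (g ≫ f), hprod, inv_mul_cancel_left]
    have h := congrArg (fun v : (tangentSpace R G).obj (op W) => v.1.app (𝟙 W) d) hw
    change (G.map (𝟙 W).op p)⁻¹ * Z.app (𝟙 W ≫ f) (G.map (𝟙 W).op p) d =
      (H.bracket s t).1.app (𝟙 W ≫ f) d at h
    rw [map_id_op, Category.id_comp, inv_mul_eq_iff_eq_mul] at h
    exact h
  · rintro rfl W f p d₁ d₂
    exact (hprod f p d₁ d₂).symm

end IsLieGroup

end InD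

end SDG

/-! ### Assembly of the theorem -/

theorem mainTheorem5 {C : Type u} [SmallCategory C] (J : GrothendieckTopology C)
    (R : Cᵒᵖ ⥤ Type u) [SDG.InternalAlgebra R] (hR : Presieve.IsSheaf J R)
    (hI : SDG.KockLawvereI R) (hII : SDG.KockLawvereII R)
    (n : ℕ) (G : Cᵒᵖ ⥤ Type u) [SDG.InternalGroup G] (hG : SDG.IsFormalManifold J R n G) :
    -- the Lie bracket of points is a well-defined total operation on `𝔐(e)`
    (∀ (U : C) (P Q : G.obj (op U)), SDG.InMonad J R n G 1 P → SDG.InMonad J R n G 1 Q →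
      (∃! S : G.obj (op U), SDG.IsPointBracket J R n P Q S) ∧
      ∀ S : G.obj (op U), SDG.IsPointBracket J R n P Q S → SDG.InMonad J R n G 1 S) ∧
    -- it induces a Lie algebra structure on the `R`-module `T_e G`
    ∃ (_ : SDG.InternalLieRing (SDG.tangentSpace R G))
      (_ : SDG.InternalLieAlgebra R (SDG.tangentSpace R G)),
      SDG.PointwiseLinear R J n G ∧
      SDG.LogBijective R J n G ∧
      -- whose bracket extends the exp-log lift of the Lie bracket of points,
      (∀ U : C, SDG.LiftsPointBracket R J n (G := G) (U := U) (fun _ _ s t => ⁅s, t⁆)) ∧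
      -- is the only bilinear map to do so,
      (∀ (U : C) (B : SDG.StageBilin R (SDG.tangentSpace R G) (SDG.tangentSpace R G) U),
        SDG.LiftsPointBracket R J n (fun _ f s t => B.app f s t) →
        ∀ ⦃W : C⦄ (f : W ⟶ U) (s t : (SDG.tangentSpace R G).obj (op W)), B.app f s t = ⁅s, t⁆) ∧
      -- and is the Lie bracket of left-invariant vector fields
      (∀ (U : C) (s t : (SDG.tangentSpace R G).obj (op U)) (Z : SDG.VectorField R G U),
        SDG.IsLieBracket (SDG.leftInvariant s) (SDG.leftInvariant t) Z ↔
          Z = SDG.leftInvariant ⁅s, t⁆) := by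
  have H : SDG.IsLieGroup J R n G := ⟨hR, hI, hII, hG⟩
  refine ⟨fun U P Q hP hQ => ⟨⟨_, (H.isPointBracket_iff hP hQ).2 rfl, fun S hS =>
      (H.isPointBracket_iff hP hQ).1 hS⟩, fun S hS => ?_⟩,
    H.internalLieRing, H.internalLieAlgebra, H.pointwiseLinear, H.logBijective,
    H.liftsPointBracket, fun U => H.eq_bracket_of_liftsPointBracket, fun U => H.isLieBracket_iff⟩
  rw [(H.isPointBracket_iff hP hQ).1 hS]
  exact H.inMonad_commutator hP hQ
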